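/- Let $n\ge 0$, $[n+1]=\{1,\dots,n+1\}$, let $e_j$ be the standard basis vectors, $a_j:=i\,e_j\in\mathbb{C}^{n+1}$, $v:=(1,\dots,1)$, $v_j:=v-e_j\in\mathbb{R}^{n+1}$, and write $w^2:=\sum_l w_l^2$ for $w\in\mathbb{C}^{n+1}$. For $\emptyset\ne I\subset[n+1]$ let $c_I\in\mathbb{C}^{n+1}$ have coordinates $i/|I|$ at the positions in $I$ and $0$ elsewhere. Let $\mathcal{I}$ be the set of tuples $i=(I_1,\dots,I_k,J_\le,J_\ge,\prec)$ with $k\ge1$, $\emptyset\neq I_1\subsetneq\dots\subsetneq I_k\subset[n+1]$, disjoint $J_\le,J_\ge\subset[n+1]\setminus I_k$, and $\prec\,\in\{\le,=\}$; put $J_i:=J_\le\cup J_\ge$. For $\tau\in\{-1,0,1\}$ let $V^\tau_{J_\le,J_\ge}:=\tau\,\mathbb{R}_{\ge0}v+\sum_{j\in J_\le}\mathbb{R}_{\le0}v_j+\sum_{j\in J_\ge}\mathbb{R}_{\ge0}v_j$ and $$e_i^\tau:=\{z\in\mathbb{C}^{n+1}\mid i\cdot\mathrm{Im}\,z\in\mathrm{conv}(c_{I_1},\dots,c_{I_k}),\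 \mathrm{Re}\,z\in V^\tau_{J_\le,J_\ge},\ (z-a_{\min I_1})^2\prec1\},$$ where $w\le 1$ for $w\in\mathbb{C}$ means that $w$ is real and at most $1$. Let $Y:=\bigcup_{\tau}\bigcup_{i\in\mathcal{I}}e_i^\tau$. The set $e_i^\tau$ is empty if and only if $\prec$ is $=$, $J_i=\emptyset$ and $\tau=0$. The set $Y$ has the structure of a regular CW complex of dimension $n+1$ whose closed cells are exactly the nonempty sets $e_i^\tau$ (different pairs $(i,\tau)$ giving different cells). Every nonempty $e_i^\tau$ is homeomorphic to $\Delta^p\times\Delta^{k-1}$ with $p=|J_i|+|\tau|$ if $\prec$ is $\le$ and $p=|J_i|+|\tau|-1$ if $\prec$ is $=$; in particular it is a cell of dimension $p+k-1$. The homeomorphisms can be chosen such that, when every cell is oriented by the product orientation of $\Delta^p\times\Delta^{k-1}$ (that is, $e_i^\tau$ also denotes the image in the cellular chain group $H_{p+k-1}(Y^{p+k-1},Y^{p+k-2})$ of the cross product of the fundamental classes of the two simplices), the boundary in the cellular chain complex of $Y$ is, for all $i=(I_1,\dots,I_k,J_\le,J_\ge,\prec)\in\mathcal{I}$ and $\tau\in\{-1,0,1\}$,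 $$\begin{aligned}\partial e_i^\tau={}&\delta_{|\tau|,1}(-1)^{|J_i|}\,e_i^0+\delta_{\prec,\le}(-1)^{|J_i|+|\tau|}\,e^\tau_{(I_1,\dots,I_k,J_\le,J_\ge,=)}+\sum_{j\in J_i}(-1)^{n_i(j)-1}\,e^\tau_{(I_1,\dots,I_k,J_\le\setminus\{j\},J_\ge\setminus\{j\},\prec)}\\&+(-1)^{|J_i|+|\tau|+\delta_{\prec,\le}-1}\sum_{j=1}^k(-1)^{j-1}\,e^\tau_{(I_1,\dots,\widehat{I_j},\dots,I_k,J_\le,J_\ge,\prec)},\end{aligned}$$ where $n_i:J_i\to\{1,\dots,|J_i|\}$ is the order-preserving bijection, $\delta_{\prec,\le}$ is $1$ if $\prec$ is $\le$ and $0$ otherwise, and terms belonging to empty sets $e_i^\tau$, as well as the last sum when $k=1$, count as $0$. -/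

import Mathlib

noncomputable section

namespace SphereComplex

/-! ### Singular chains, relative singular homology and cellular chains -/

section Singular

/-- The (continuous, affine) map of standard simplices given by a map of vertices. -/
def simplexMap {a b : ℕ} (f : Fin (a + 1) → Fin (b + 1)) :
    C(stdSimplex ℝ (Fin (a + 1)), stdSimplex ℝ (Fin (b + 1))) :=
  ⟨stdSimplex.map f, stdSimplex.continuous_map f⟩

/-- Singular `d`-chains of `X` with integer coefficients. -/
abbrev SingularChain (X : Type) [TopologicalSpace X] (d : ℕ) : Type :=
  C(stdSimplex ℝ (Fin (d + 1)), X) →₀ ℤ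

/-- The chain map induced by a continuous map. -/
def pushChain {X Y : Type} [TopologicalSpace X] [TopologicalSpace Y] (g : C(X, Y)) (d : ℕ) :
    SingularChain X d →ₗ[ℤ] SingularChain Y d :=
  Finsupp.lmapDomain ℤ ℤ (fun σ => g.comp σ)

variable {X : Type} [TopologicalSpace X]

/-- The singular boundary `∂σ = ∑ j, (-1) ^ j • (σ restricted to the face omitting vertex j)`. -/
def singularBoundary (d : ℕ) : SingularChain X (d + 1) →ₗ[ℤ] SingularChain X d :=
  ∑ j : Fin (d + 2),
    (-1 : ℤ) ^ (j : ℕ) • Finsupp.lmapDomain ℤ ℤ (fun σ => σ.comp (simplexMap j.succAbove))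

theorem simplexMap_comp {a b c : ℕ} (g : Fin (b + 1) → Fin (c + 1)) (f : Fin (a + 1) → Fin (b + 1)) :
    (simplexMap g).comp (simplexMap f) = simplexMap (g ∘ f) := by
  ext1 x
  exact stdSimplex.map_comp_apply f g x

theorem singularBoundary_singularBoundary (d : ℕ) (c : SingularChain X (d + 2)) :
    singularBoundary d (singularBoundary (d + 1) c) = 0 := by
  induction c using Finsupp.induction_linear with
  | zero => simp
  | add f g hf hg => rw [map_add, map_add, hf, hg, add_zero]
  | single σ a =>
    simp only [singularBoundary, LinearMap.sum_apply, LinearMap.smul_apply, map_sum, map_smul,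
      Finsupp.lmapDomain_apply, Finsupp.mapDomain_single, ContinuousMap.comp_assoc, simplexMap_comp]
    simp only [Finset.smul_sum, smul_smul, ← pow_add]
    rw [← Finset.sum_product', Finset.univ_product_univ]
    have key : ∀ (x : Fin (d + 3)) (y : Fin (d + 2)),
        (-1 : ℤ) ^ ((x : ℕ) + (y : ℕ)) +
          (-1 : ℤ) ^ ((x.succAbove y : ℕ) + (y.predAbove x : ℕ)) = 0 := by
      intro x y
      rcases Fin.lt_or_le y.castSucc x with h | h
      · rw [Fin.succAbove_of_castSucc_lt _ _ h, Fin.predAbove_of_castSucc_lt _ _ h]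
        have hx : (x : ℕ) = (x.pred (Fin.ne_zero_of_lt h) : ℕ) + 1 := by
          have := Fin.val_fin_lt.mpr h
          rw [Fin.val_castSucc] at this
          rw [Fin.val_pred]
          omega
        rw [hx, Fin.val_castSucc]
        ring
      · rw [Fin.succAbove_of_le_castSucc _ _ h, Fin.predAbove_of_le_castSucc _ _ h,
          Fin.val_succ, Fin.coe_castPred]
        ring
    refine Finset.sum_involution (fun x _ => (x.1.succAbove x.2, x.2.predAbove x.1)) ?_ ?_ ?_ ?_
    · rintro ⟨x, y⟩ _
      have hf : (x.succAbove y).succAbove ∘ (y.predAbove x).succAbove =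
          x.succAbove ∘ y.succAbove := by
        funext k
        exact Fin.succAbove_succAbove_succAbove_predAbove x y k
      simp only [hf]
      rw [← add_smul, key, zero_smul]
    · rintro ⟨x, y⟩ _ _ h
      exact Fin.succAbove_ne x y (congrArg Prod.fst h)
    · intros
      exact Finset.mem_univ _
    · rintro ⟨x, y⟩ _
      simp only [Fin.succAbove_succAbove_predAbove, Prod.mk.injEq, true_and]
      exact Fin.predAbove_predAbove_succAbove x y

/-- Chains of `X` all of whose simplices lie in the subset `A`, i.e. singular chains of `A`. -/
def chainsIn (A : Set X) (d : ℕ) : Submodule ℤ (SingularChain X d) :=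
  Finsupp.supported ℤ ℤ {σ | Set.range σ ⊆ A}

/-- Relative cycles of the pair `(A, B)`: chains in `A` whose boundary is a chain in `B`. -/
def relCycles (A B : Set X) : (d : ℕ) → Submodule ℤ (SingularChain X d)
  | 0 => chainsIn A 0
  | d + 1 => chainsIn A (d + 1) ⊓ (chainsIn B d).comap (singularBoundary d)

/-- Relative boundaries of the pair `(A, B)`: chains `∂a + b` with `a` in `A` and `b` in `B`. -/
def relBoundaries (A B : Set X) (d : ℕ) : Submodule ℤ (SingularChain X d) :=
  (chainsIn A (d + 1)).map (singularBoundary d) ⊔ chainsIn B d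

/-- The relative singular homology `H_d(A, B)` of subspaces `B ⊆ A` of `X` (relative cycles modulo
relative boundaries). -/
abbrev RelHomology (A B : Set X) (d : ℕ) : Type :=
  relCycles A B d ⧸ (relBoundaries A B d).submoduleOf (relCycles A B d)

/-- The boundary of relative cycles of `(A, B)` as relative cycles of `(B, C)`. -/
def cycleBoundary (A B C : Set X) (d : ℕ) : relCycles A B (d + 1) →ₗ[ℤ] relCycles B C d :=
  (singularBoundary d).restrict (by
    intro c hc
    cases d with
    | zero => exact hc.2
    | succ d =>
      refine ⟨hc.2, ?_⟩
      change singularBoundary d (singularBoundary (d + 1) c) ∈ chainsIn C d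
      rw [singularBoundary_singularBoundary]
      exact Submodule.zero_mem _)

/-- The boundary homomorphism `H_{d+1}(A, B) → H_d(B, C)`, `[c] ↦ [∂c]`, of a triple. -/
def tripleBoundary (A B C : Set X) (d : ℕ) : RelHomology A B (d + 1) →ₗ[ℤ] RelHomology B C d :=
  Submodule.mapQ _ _ (cycleBoundary A B C d) (by
    rintro ⟨c, hc⟩ hcb
    obtain ⟨_, ⟨a, _, rfl⟩, b, hb, rfl⟩ := Submodule.mem_sup.mp hcb
    refine Submodule.mem_sup_left ⟨b, hb, ?_⟩
    change _ = singularBoundary d (singularBoundary (d + 1) a + b)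
    rw [map_add, singularBoundary_singularBoundary, zero_add])

variable [T2Space X]

/-- The union of the closed cells of dimension `< d`. -/
def skel (Y : Set X) [Topology.CWComplex Y] (d : ℕ) : Set X :=
  (Topology.CWComplex.skeletonLT Y (d : ℕ∞) : Set X)

/-- The cellular chain group `H_d(Y^d, Y^{d-1})` of a CW complex `Y`. -/
abbrev CellularChain (Y : Set X) [Topology.CWComplex Y] (d : ℕ) : Type :=
  RelHomology (skel Y (d + 1)) (skel Y d) d

/-- The cellular boundary `H_{d+1}(Y^{d+1}, Y^d) → H_d(Y^d, Y^{d-1})`. -/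
def cellularBoundary (Y : Set X) [Topology.CWComplex Y] (d : ℕ) :
    CellularChain Y (d + 1) →ₗ[ℤ] CellularChain Y d :=
  tripleBoundary _ _ _ d

/-- The cellular chain represented by a relative cycle. -/
def cellularClass (Y : Set X) [Topology.CWComplex Y] {d : ℕ} (c : SingularChain X d)
    (hc : c ∈ relCycles (skel Y (d + 1)) (skel Y d) d) : CellularChain Y d :=
  Submodule.Quotient.mk ⟨c, hc⟩

open scoped Classical in
/-- For `d = p + q`: the fundamental chain of `Δ^p × Δ^q` with its product orientation, that is the
cross product (Eilenberg–Zilber shuffle product) of the identity simplices of `Δ^p` and `Δ^q`. The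
sum is over the maximal chains `f` of vertices in the grid, each giving an affine simplex, and the
exponent (the number of grid squares below the lattice path `f`) gives the sign of the shuffle. -/
def productChain (p q d : ℕ) :
    SingularChain (stdSimplex ℝ (Fin (p + 1)) × stdSimplex ℝ (Fin (q + 1))) d :=
  ∑ f : {f : Fin (d + 1) → Fin (p + 1) × Fin (q + 1) // StrictMono f},
    (-1 : ℤ) ^ (∑ t : Fin d, (((f.1 t.succ).1 : ℕ) - (f.1 t.castSucc).1) * (f.1 t.castSucc).2) •
      Finsupp.single ((simplexMap fun t => (f.1 t).1).prodMk (simplexMap fun t => (f.1 t).2)) 1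

end Singular

/-! ### The sets `e_i^τ` -/

section Cells

/-- `a_j = i · e_j`, with `e_j` the `j`-th standard basis vector. -/
def sphereCenter {n : ℕ} (j : Fin (n + 1)) : Fin (n + 1) → ℂ := Pi.single j Complex.I

/-- The centre `c_I` with coordinates `i / |I|` on `I` and `0` elsewhere. -/
def center {n : ℕ} (I : Finset (Fin (n + 1))) : Fin (n + 1) → ℂ :=
  fun j => if j ∈ I then Complex.I / (I.card : ℂ) else 0

/-- The vector `v = (1, …, 1)`. -/
def vecV (n : ℕ) : Fin (n + 1) → ℝ := fun _ => 1

/-- The vector `v_j = v - e_j`. -/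
def vecVj {n : ℕ} (j : Fin (n + 1)) : Fin (n + 1) → ℝ := vecV n - Pi.single j 1

/-- The cone `V^τ_{J_≤, J_≥} = τ ℝ_{≥0} v + ∑_{J_≤} ℝ_{≤0} v_j + ∑_{J_≥} ℝ_{≥0} v_j`. -/
def coneV {n : ℕ} (Jle Jge : Finset (Fin (n + 1))) (τ : SignType) : Set (Fin (n + 1) → ℝ) :=
  {x | ∃ (t : ℝ) (c : Fin (n + 1) → ℝ), 0 ≤ t ∧ (∀ j ∈ Jle, c j ≤ 0) ∧ (∀ j ∈ Jge, 0 ≤ c j) ∧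
    x = ((τ : ℝ) * t) • vecV n + ∑ j ∈ Jle, c j • vecVj j + ∑ j ∈ Jge, c j • vecVj j}

/-- The two possible values of the symbol `≺`. -/
inductive Prec : Type
  | le : Prec
  | eq : Prec

/-- `w ≺ 1` for a complex number `w` (for `≤` this means that `w` is real and at most `1`). -/
def Prec.holdsOne : Prec → ℂ → Prop
  | .le, w => w.im = 0 ∧ w.re ≤ 1
  | .eq, w => w = 1

/-- The Kronecker delta `δ_{≺, ≤}`. -/
def Prec.delta : Prec → ℕ
  | .le => 1
  | .eq => 0

/-- The index set: tuples `(I_1, …, I_k, J_≤, J_≥, ≺)` with `k ≥ 1`,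
`∅ ≠ I_1 ⊊ ⋯ ⊊ I_k ⊆ {1, …, n+1}` and disjoint `J_≤, J_≥ ⊆ {1, …, n+1} \ I_k`. -/
structure Idx (n : ℕ) : Type where
  chain : List (Finset (Fin (n + 1)))
  chain_ne_nil : chain ≠ []
  nonempty : ∀ I ∈ chain, I.Nonempty
  strict : chain.Pairwise (· ⊂ ·)
  Jle : Finset (Fin (n + 1))
  Jge : Finset (Fin (n + 1))
  Jle_disjoint : Disjoint Jle (chain.getLast chain_ne_nil)
  Jge_disjoint : Disjoint Jge (chain.getLast chain_ne_nil)
  J_disjoint : Disjoint Jle Jge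
  prec : Prec

namespace Idx

variable {n : ℕ}

/-- `J_i = J_≤ ∪ J_≥`. -/
def J (i : Idx n) : Finset (Fin (n + 1)) := i.Jle ∪ i.Jge

/-- `min I_1`. -/
def minHead (i : Idx n) : Fin (n + 1) :=
  (i.chain.head i.chain_ne_nil).min' (i.nonempty _ (List.head_mem _))

/-- The index with `≺` replaced by `=`. -/
def toEq (i : Idx n) : Idx n := { i with prec := .eq }

/-- The index with `j` removed from `J_≤` and `J_≥`. -/
def eraseJ (i : Idx n) (j : Fin (n + 1)) : Idx n :=
  { i with
    Jle := i.Jle.erase j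
    Jge := i.Jge.erase j
    Jle_disjoint := i.Jle_disjoint.mono_left (Finset.erase_subset _ _)
    Jge_disjoint := i.Jge_disjoint.mono_left (Finset.erase_subset _ _)
    J_disjoint := i.J_disjoint.mono (Finset.erase_subset _ _) (Finset.erase_subset _ _) }

theorem subset_getLast (i : Idx n) {I : Finset (Fin (n + 1))} (hI : I ∈ i.chain) :
    I ⊆ i.chain.getLast i.chain_ne_nil := by
  have h := i.strict
  rw [← List.dropLast_append_getLast i.chain_ne_nil] at hI h
  rcases List.mem_append.mp hI with h1 | h1
  · exact ((List.pairwise_append.mp h).2.2 I h1 _ (by simp)).subset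
  · simp only [List.mem_singleton] at h1
    exact h1.subset

/-- The index with `I_{j+1}` removed from the chain (`j` counts from `0`), where `k ≥ 2`. -/
def eraseI (i : Idx n) (j : Fin i.chain.length) (h : 1 < i.chain.length) : Idx n :=
  have hne : i.chain.eraseIdx j ≠ [] := by
    intro h0
    have := congrArg List.length h0
    rw [List.length_eraseIdx_of_lt j.2, List.length_nil] at this
    omega
  have hlast := i.subset_getLast ((List.eraseIdx_sublist _ _).mem (List.getLast_mem hne))
  { i with
    chain := i.chain.eraseIdx j
    chain_ne_nil := hne
    nonempty := fun I hI => i.nonempty I ((List.eraseIdx_sublist _ _).mem hI)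
    strict := i.strict.sublist (List.eraseIdx_sublist _ _)
    Jle_disjoint := i.Jle_disjoint.mono_right hlast
    Jge_disjoint := i.Jge_disjoint.mono_right hlast }

/-- The set `e_i^τ ⊆ ℂ^{n+1}`: points `z` with `i · Im z` in the simplex spanned by
`c_{I_1}, …, c_{I_k}`, with `Re z` in the cone `V^τ` and with `(z - a_{min I_1})² ≺ 1`. -/
def cellSet (i : Idx n) (τ : SignType) : Set (Fin (n + 1) → ℂ) :=
  {z | (fun l => Complex.I * ((z l).im : ℂ)) ∈ convexHull ℝ (center '' {I | I ∈ i.chain}) ∧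
    (fun l => (z l).re) ∈ coneV i.Jle i.Jge τ ∧
    i.prec.holdsOne (∑ l, (z l - sphereCenter i.minHead l) ^ 2)}

/-- `|τ|` as a natural number. -/
def absSign (τ : SignType) : ℕ := (τ : ℤ).natAbs

/-- The dimension of the first simplex factor of `e_i^τ`: it is `m = |J_i| + |τ|` if `≺` is `≤`
and `m - 1` if `≺` is `=` (for `m = 0` and `=`, the set `e_i^τ` is empty). -/
def dimFst (i : Idx n) (τ : SignType) : ℕ := i.J.card + absSign τ + i.prec.delta - 1

/-- The dimension of the second simplex factor `e_{I_1,…,I_k}` of `e_i^τ`. -/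
def dimSnd (i : Idx n) : ℕ := i.chain.length - 1

/-- The dimension of the cell `e_i^τ`. -/
def dim (i : Idx n) (τ : SignType) : ℕ := i.dimFst τ + i.dimSnd

end Idx

/-- The union `Y` of all sets `e_i^τ`. -/
def unionY (n : ℕ) : Set (Fin (n + 1) → ℂ) := ⋃ (τ : SignType) (i : Idx n), i.cellSet τ

/-- The right-hand side of the boundary formula for `e_i^τ`, where `e i τ` stands for (the
cellular chain of) `e_i^τ`. A simplex spanned by an empty chain of sets counts as zero. -/
def boundaryFormula {n : ℕ} {M : Type} [AddCommGroup M] (e : Idx n → SignType → M)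
    (i : Idx n) (τ : SignType) : M :=
  (if τ = 0 then 0 else (-1 : ℤ) ^ i.J.card • e i 0) +
  (match i.prec with
    | .le => (-1 : ℤ) ^ (i.J.card + Idx.absSign τ) • e i.toEq τ
    | .eq => 0) +
  ∑ j ∈ i.J, (-1 : ℤ) ^ (i.J.filter (· < j)).card • e (i.eraseJ j) τ +
  (-1 : ℤ) ^ (i.J.card + Idx.absSign τ + i.prec.delta - 1) •
    ∑ j : Fin i.chain.length,
      (-1 : ℤ) ^ (j : ℕ) • (if h : 1 < i.chain.length then e (i.eraseI j h) τ else 0)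

end Cells

end SphereComplex

end

/-!
The points `x + i y` of `Y` are described by two kinds of barycentric coordinates. The weights `u` on
the sets of a chain give `y`, through barycentric subdivision; every `m ∈ I_1` is a position of a
largest coordinate of `y`, so for `y` fixed the condition on `(z - a_m)²` says that `x` lies in the
ball, or on the sphere, of radius `radius y`, and this number does not depend on the cell. The part
`x` is given by signed weights `W` on `n + 3` labels, one for each direction `v_j`, one for `v`, and one
for the origin, whose weight measures how far `x` is from that sphere (`weightPoint`). A cell `e_i^τ` is
cut out by prescribing the signs of `W` (`Idx.signs`) and the chain supporting `u`
(`Idx.mem_cellSet`), and it is nonempty exactly if some sign is nonzero.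

The key fact is `Idx.weights_unique`: the weights `(W, u)` of a point of `Y` are determined by the
point, for all cells at once. It shows that the restriction `Idx.param` of `weightPoint` to a cell is a
homeomorphism from a product of two simplices, and that open cells are disjoint, since strictly
positive coordinates determine the signs and the chain. A point with a vanishing coordinate lies in
the cell where a sign is set to `0` or a set is removed from the chain. Hence `Y` is a finite regular
CW complex (`cwStructure`).

For the boundary formula, the vertices of each factor are listed in a fixed order common to all cells:
`v_1, …, v_{n+1}, v`, the origin, and the sets of the chain by inclusion. Then the parametrization of
a cell restricts to the parametrizations of its faces, so the formula holds for the singular chains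
`Idx.cellChain` themselves and not only for their classes (`Idx.singularBoundary_cellChain`). It is the
Leibniz rule for the cross product of two simplices. That rule, `tupleBoundary_shuffle`, is proved for
formal tuples of grid points by induction on the dimension: removing the last vertex of a lattice path
from `(0, 0)` to `(p, q)` leaves a path to `(p - 1, q)` or to `(p, q - 1)`.
-/


noncomputable section

namespace SphereComplex

/-! ### The Leibniz rule for shuffle products -/

section Shuffle

/-- Integral combinations of `m`-tuples of vertices. -/
abbrev TupleChain (α : Type) (m : ℕ) : Type := (Fin m → α) →₀ ℤ

variable {α β : Type}

/-- The alternating sum of the faces of a tuple of vertices. -/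
def tupleBoundary (m : ℕ) : TupleChain α (m + 1) →ₗ[ℤ] TupleChain α m :=
  ∑ j : Fin (m + 1), (-1 : ℤ) ^ (j : ℕ) • Finsupp.lmapDomain ℤ ℤ (fun F => F ∘ j.succAbove)

/-- Appending the vertex `v` to all tuples. -/
def tupleSnoc (v : α) (m : ℕ) : TupleChain α m →ₗ[ℤ] TupleChain α (m + 1) :=
  Finsupp.lmapDomain ℤ ℤ (fun F => Fin.snoc (α := fun _ => α) F v)

/-- Applying a map of vertices to all tuples. -/
def tupleMap (h : α → β) (m : ℕ) : TupleChain α m →ₗ[ℤ] TupleChain β m :=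
  Finsupp.lmapDomain ℤ ℤ (fun F => h ∘ F)

@[simp] lemma tupleSnoc_single (v : α) (m : ℕ) (F : Fin m → α) (k : ℤ) :
    tupleSnoc v m (Finsupp.single F k) =
      Finsupp.single (Fin.snoc (α := fun _ => α) F v : Fin (m + 1) → α) k := by
  simp [tupleSnoc]

@[simp] lemma tupleMap_single (h : α → β) (m : ℕ) (F : Fin m → α) (k : ℤ) :
    tupleMap h m (Finsupp.single F k) = Finsupp.single (h ∘ F) k := by
  simp [tupleMap]

lemma tupleBoundary_single (m : ℕ) (F : Fin (m + 1) → α) (k : ℤ) :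
    tupleBoundary m (Finsupp.single F k) =
      ∑ j : Fin (m + 1), (-1 : ℤ) ^ (j : ℕ) • Finsupp.single (F ∘ j.succAbove) k := by
  simp [tupleBoundary, LinearMap.sum_apply]

lemma tupleMap_tupleSnoc (h : α → β) (v : α) (m : ℕ) (c : TupleChain α m) :
    tupleMap h (m + 1) (tupleSnoc v m c) = tupleSnoc (h v) m (tupleMap h m c) := by
  induction c using Finsupp.induction_linear with
  | zero => simp
  | add f g hf hg => simp only [map_add, hf, hg]
  | single F k =>
    simp only [tupleSnoc_single, tupleMap_single]
    congr 1
    funext t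
    refine Fin.lastCases ?_ (fun t => ?_) t <;> simp

lemma tupleBoundary_tupleSnoc (v : α) (m : ℕ) (c : TupleChain α (m + 1)) :
    tupleBoundary (m + 1) (tupleSnoc v (m + 1) c) =
      tupleSnoc v m (tupleBoundary m c) + (-1 : ℤ) ^ (m + 1) • c := by
  induction c using Finsupp.induction_linear with
  | zero => simp
  | add f g hf hg => rw [map_add, map_add, hf, hg, map_add, map_add, smul_add]; abel
  | single F k =>
    rw [tupleSnoc_single, tupleBoundary_single, tupleBoundary_single, Fin.sum_univ_castSucc,
      map_sum]
    congr 1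
    · refine Finset.sum_congr rfl fun j _ => ?_
      rw [map_smul, tupleSnoc_single, Fin.val_castSucc]
      congr 2
      funext t
      refine Fin.lastCases ?_ (fun t => ?_) t
      · have : j.castSucc.succAbove (Fin.last m) = Fin.last (m + 1) := by
          rw [Fin.succAbove_of_le_castSucc _ _ (Fin.castSucc_le_castSucc_iff.mpr (Fin.le_last j)),
            Fin.succ_last]
        simp [this]
      · rw [Function.comp_apply, Fin.snoc_castSucc, Fin.castSucc_succAbove_castSucc,
          Fin.snoc_castSucc, Function.comp_apply]
    · rw [Fin.val_last]
      congr 2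
      funext t
      simp

/-- The lattice paths in the grid `P × Q` with `d + 1` vertices, that is, the strictly increasing
tuples of grid points. -/
def gridPaths (P Q d : ℕ) : Finset (Fin (d + 1) → ℕ × ℕ) :=
  open scoped Classical in
  (Fintype.piFinset fun _ => Finset.range P ×ˢ Finset.range Q).filter StrictMono

lemma mem_gridPaths {P Q d : ℕ} {F : Fin (d + 1) → ℕ × ℕ} :
    F ∈ gridPaths P Q d ↔ (∀ t, (F t).1 < P ∧ (F t).2 < Q) ∧ StrictMono F := by
  simp [gridPaths]

/-- The number of grid squares below a lattice path. -/
def pathArea {d : ℕ} (F : Fin (d + 1) → ℕ × ℕ) : ℕ :=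
  ∑ t : Fin d, ((F t.succ).1 - (F t.castSucc).1) * (F t.castSucc).2

/-- The signed sum of the lattice paths in the grid `P × Q`; for `P + Q = d + 2` it is the shuffle
product of the ordered simplices with `P` and `Q` vertices. -/
def shuffle (P Q d : ℕ) : TupleChain (ℕ × ℕ) (d + 1) :=
  ∑ F ∈ gridPaths P Q d, (-1 : ℤ) ^ pathArea F • Finsupp.single F 1

lemma le_sum_of_strictMono {d : ℕ} {F : Fin (d + 1) → ℕ × ℕ} (hF : StrictMono F)
    (t : Fin (d + 1)) : (t : ℕ) ≤ (F t).1 + (F t).2 := by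
  have hlt : ∀ a b : ℕ × ℕ, a < b → a.1 + a.2 < b.1 + b.2 := by
    intro a b h
    rcases Prod.lt_iff.mp h with h | h <;> omega
  induction t using Fin.induction with
  | zero => simp
  | succ t ih =>
    have := hlt _ _ (hF t.castSucc_lt_succ)
    simp only [Fin.val_castSucc, Fin.val_succ] at *
    omega

lemma gridPaths_last {P Q d : ℕ} (h : P + Q = d + 2) {F : Fin (d + 1) → ℕ × ℕ}
    (hF : F ∈ gridPaths P Q d) :
    (F (Fin.last d)).1 + 1 = P ∧ (F (Fin.last d)).2 + 1 = Q := by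
  rw [mem_gridPaths] at hF
  have h1 := le_sum_of_strictMono hF.2 (Fin.last d)
  have h2 := hF.1 (Fin.last d)
  rw [Fin.val_last] at h1
  omega

lemma gridPaths_zero_left {Q d : ℕ} : gridPaths 0 Q d = ∅ := by
  ext F
  simp [mem_gridPaths]

lemma gridPaths_zero_right {P d : ℕ} : gridPaths P 0 d = ∅ := by
  ext F
  simp [mem_gridPaths]

@[simp] lemma shuffle_zero_left (Q d : ℕ) : shuffle 0 Q d = 0 := by
  simp [shuffle, gridPaths_zero_left]

@[simp] lemma shuffle_zero_right (P d : ℕ) : shuffle P 0 d = 0 := by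
  simp [shuffle, gridPaths_zero_right]

lemma strictMono_snoc {d : ℕ} {F : Fin (d + 1) → ℕ × ℕ} {v : ℕ × ℕ} (hF : StrictMono F)
    (hv : F (Fin.last d) < v) :
    StrictMono (Fin.snoc (α := fun _ => ℕ × ℕ) F v : Fin (d + 2) → ℕ × ℕ) := by
  rw [Fin.strictMono_iff_lt_succ]
  intro t
  refine Fin.lastCases ?_ (fun t => ?_) t
  · simpa using hv
  · rw [Fin.succ_castSucc, Fin.snoc_castSucc, Fin.snoc_castSucc]
    exact hF t.castSucc_lt_succ

lemma pathArea_snoc {d : ℕ} (F : Fin (d + 1) → ℕ × ℕ) (v : ℕ × ℕ) :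
    pathArea (Fin.snoc (α := fun _ => ℕ × ℕ) F v : Fin (d + 2) → ℕ × ℕ) =
      pathArea F + (v.1 - (F (Fin.last d)).1) * (F (Fin.last d)).2 := by
  rw [pathArea, Fin.sum_univ_castSucc]
  congr 1
  · refine Finset.sum_congr rfl fun t _ => ?_
    rw [Fin.succ_castSucc, Fin.snoc_castSucc, Fin.snoc_castSucc]
  · simp

/-- A maximal lattice path arrives at the last grid point either horizontally or vertically. -/
lemma gridPaths_succ {P Q d : ℕ} (h : P + Q = d + 1) :
    gridPaths (P + 1) (Q + 1) (d + 1) =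
      (gridPaths P (Q + 1) d).image (fun F => Fin.snoc (α := fun _ => ℕ × ℕ) F (P, Q)) ∪
      (gridPaths (P + 1) Q d).image (fun F => Fin.snoc (α := fun _ => ℕ × ℕ) F (P, Q)) := by
  classical
  ext F
  simp only [Finset.mem_union, Finset.mem_image]
  constructor
  · intro hF
    have hl := gridPaths_last (by omega) hF
    rw [mem_gridPaths] at hF
    obtain ⟨hb, hm⟩ := hF
    have hFl : F (Fin.last (d + 1)) = (P, Q) := by ext <;> simp <;> omega
    have hinit : StrictMono (Fin.init F) := fun a b hab => hm (Fin.castSucc_lt_castSucc_iff.mpr hab)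
    have hlt : F (Fin.last d).castSucc < (P, Q) := by
      rw [← hFl]; exact hm (Fin.castSucc_lt_last _)
    have hle : ∀ t : Fin (d + 1), F t.castSucc ≤ F (Fin.last d).castSucc := fun t =>
      hm.monotone (Fin.castSucc_le_castSucc_iff.mpr (Fin.le_last t))
    have hsn : Fin.snoc (α := fun _ => ℕ × ℕ) (Fin.init F) (P, Q) = F := by
      rw [← hFl]; exact Fin.snoc_init_self F
    by_cases hc : (F (Fin.last d).castSucc).1 < P
    · refine Or.inl ⟨Fin.init F, mem_gridPaths.mpr ⟨fun t => ⟨?_, (hb _).2⟩, hinit⟩, hsn⟩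
      exact lt_of_le_of_lt (hle t).1 hc
    · refine Or.inr ⟨Fin.init F, mem_gridPaths.mpr ⟨fun t => ⟨(hb _).1, ?_⟩, hinit⟩, hsn⟩
      refine lt_of_le_of_lt (hle t).2 ?_
      rcases Prod.lt_iff.mp hlt with h1 | h1
      · exact absurd h1.1 hc
      · exact h1.2
  · rintro (⟨F, hF, rfl⟩ | ⟨F, hF, rfl⟩)
    · have hl := gridPaths_last (by omega) hF
      rw [mem_gridPaths] at hF ⊢
      refine ⟨fun t => ?_, strictMono_snoc hF.2 (Prod.lt_iff.mpr (Or.inl ⟨?_, ?_⟩))⟩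
      · refine Fin.lastCases ?_ (fun t => ?_) t
        · simp
        · have := hF.1 t
          simp only [Fin.snoc_castSucc]
          omega
      · dsimp only; omega
      · dsimp only; omega
    · have hl := gridPaths_last (by omega) hF
      rw [mem_gridPaths] at hF ⊢
      refine ⟨fun t => ?_, strictMono_snoc hF.2 (Prod.lt_iff.mpr (Or.inr ⟨?_, ?_⟩))⟩
      · refine Fin.lastCases ?_ (fun t => ?_) t
        · simp
        · have := hF.1 t
          simp only [Fin.snoc_castSucc]
          omega
      · dsimp only; omega
      · dsimp only; omega

/-- The recursion for the shuffle product by the last step of the lattice paths: a horizontal last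
step has `Q` squares below it, a vertical one none. -/
lemma shuffle_succ {P Q d : ℕ} (h : P + Q = d + 1) :
    shuffle (P + 1) (Q + 1) (d + 1) =
      tupleSnoc (P, Q) (d + 1) ((-1 : ℤ) ^ Q • shuffle P (Q + 1) d + shuffle (P + 1) Q d) := by
  classical
  have hinj : Function.Injective
      (fun F : Fin (d + 1) → ℕ × ℕ => Fin.snoc (α := fun _ => ℕ × ℕ) F (P, Q)) := by
    intro F G hFG
    funext t
    simpa using congrFun hFG t.castSucc
  rw [shuffle, gridPaths_succ h, Finset.sum_union, Finset.sum_image hinj.injOn,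
    Finset.sum_image hinj.injOn, map_add]
  · congr 1
    · rw [shuffle, Finset.smul_sum, map_sum]
      refine Finset.sum_congr rfl fun F hF => ?_
      have hl := gridPaths_last (by omega) hF
      have h1 : P - (F (Fin.last d)).1 = 1 := by omega
      have h2 : (F (Fin.last d)).2 = Q := by omega
      rw [map_smul, map_smul, tupleSnoc_single, pathArea_snoc, smul_smul, h1, h2, one_mul, pow_add,
        mul_comm]
    · rw [shuffle, map_sum]
      refine Finset.sum_congr rfl fun F hF => ?_
      have hl := gridPaths_last (by omega) hF
      have h1 : P - (F (Fin.last d)).1 = 0 := by omega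
      rw [map_smul, tupleSnoc_single, pathArea_snoc, h1, zero_mul, add_zero]
  · rw [Finset.disjoint_left]
    intro G hG hG'
    obtain ⟨F, hF, rfl⟩ := Finset.mem_image.mp hG
    obtain ⟨F', hF', hFF⟩ := Finset.mem_image.mp hG'
    obtain rfl := hinj hFF
    have h1 := gridPaths_last (by omega) hF
    have h2 := gridPaths_last (by omega) hF'
    omega

/-- The order-preserving injection `ℕ → ℕ` that omits the value `a`. -/
def skip (a k : ℕ) : ℕ := if k < a then k else k + 1

lemma skip_of_le {a k : ℕ} (h : a ≤ k) : skip a k = k + 1 := if_neg (by omega)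

lemma skip_of_lt {a k : ℕ} (h : k < a) : skip a k = k := if_pos h

/-- Omitting the column `a` of a grid. -/
def skipLeft (a d : ℕ) : TupleChain (ℕ × ℕ) (d + 1) →ₗ[ℤ] TupleChain (ℕ × ℕ) (d + 1) :=
  tupleMap (Prod.map (skip a) id) (d + 1)

/-- Omitting the row `b` of a grid. -/
def skipRight (b d : ℕ) : TupleChain (ℕ × ℕ) (d + 1) →ₗ[ℤ] TupleChain (ℕ × ℕ) (d + 1) :=
  tupleMap (Prod.map id (skip b)) (d + 1)

lemma skipLeft_shuffle_self (P Q d : ℕ) : skipLeft P d (shuffle P Q d) = shuffle P Q d := by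
  rw [shuffle, map_sum]
  refine Finset.sum_congr rfl fun F hF => ?_
  rw [skipLeft, map_smul, tupleMap_single]
  congr 2
  funext t
  exact Prod.ext (skip_of_lt ((mem_gridPaths.mp hF).1 t).1) rfl

lemma skipRight_shuffle_self (P Q d : ℕ) : skipRight Q d (shuffle P Q d) = shuffle P Q d := by
  rw [shuffle, map_sum]
  refine Finset.sum_congr rfl fun F hF => ?_
  rw [skipRight, map_smul, tupleMap_single]
  congr 2
  funext t
  exact Prod.ext rfl (skip_of_lt ((mem_gridPaths.mp hF).1 t).2)

lemma skipLeft_shuffle_succ {P Q d a : ℕ} (h : P + Q = d + 1) (ha : a ≤ P) :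
    skipLeft a (d + 1) (shuffle (P + 1) (Q + 1) (d + 1)) =
      tupleSnoc (P + 1, Q) (d + 1) ((-1 : ℤ) ^ Q • skipLeft a d (shuffle P (Q + 1) d) +
        skipLeft a d (shuffle (P + 1) Q d)) := by
  rw [shuffle_succ h, skipLeft, tupleMap_tupleSnoc, map_add, map_smul, skipLeft, Prod.map_apply,
    skip_of_le ha, id]

lemma skipRight_shuffle_succ {P Q d b : ℕ} (h : P + Q = d + 1) (hb : b ≤ Q) :
    skipRight b (d + 1) (shuffle (P + 1) (Q + 1) (d + 1)) =
      tupleSnoc (P, Q + 1) (d + 1) ((-1 : ℤ) ^ Q • skipRight b d (shuffle P (Q + 1) d) +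
        skipRight b d (shuffle (P + 1) Q d)) := by
  rw [shuffle_succ h, skipRight, tupleMap_tupleSnoc, map_add, map_smul, skipRight, Prod.map_apply,
    skip_of_le hb, id]

/-- The alternating sum of the faces of the first factor of a shuffle product. -/
def facesLeft (P Q d : ℕ) : TupleChain (ℕ × ℕ) (d + 1) :=
  ∑ a ∈ Finset.range P, (-1 : ℤ) ^ a • skipLeft a d (shuffle (P - 1) Q d)

/-- The alternating sum of the faces of the second factor of a shuffle product. -/
def facesRight (P Q d : ℕ) : TupleChain (ℕ × ℕ) (d + 1) :=
  ∑ b ∈ Finset.range Q, (-1 : ℤ) ^ b • skipRight b d (shuffle P (Q - 1) d)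

lemma facesLeft_succ {P Q d : ℕ} (h : P + Q = d + 2) :
    facesLeft (P + 1) (Q + 1) (d + 1) =
      tupleSnoc (P, Q) (d + 1) ((-1 : ℤ) ^ Q • facesLeft P (Q + 1) d + (facesLeft (P + 1) Q d -
        (-1 : ℤ) ^ P • shuffle P Q d)) + (-1 : ℤ) ^ P • shuffle P (Q + 1) (d + 1) := by
  have h1 : facesLeft (P + 1) Q d - (-1 : ℤ) ^ P • shuffle P Q d =
      ∑ a ∈ Finset.range P, (-1 : ℤ) ^ a • skipLeft a d (shuffle P Q d) := by
    rw [facesLeft, Finset.sum_range_succ, Nat.add_sub_cancel, skipLeft_shuffle_self,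
      add_sub_cancel_right]
  rw [h1, facesLeft, Finset.sum_range_succ, Nat.add_sub_cancel, skipLeft_shuffle_self]
  congr 1
  rw [facesLeft, Finset.smul_sum, ← Finset.sum_add_distrib, map_sum]
  refine Finset.sum_congr rfl fun a ha => ?_
  obtain ⟨P, rfl⟩ : ∃ P', P = P' + 1 := ⟨P - 1, by have := Finset.mem_range.mp ha; omega⟩
  rw [skipLeft_shuffle_succ (by omega) (by have := Finset.mem_range.mp ha; omega),
    Nat.add_sub_cancel, ← map_smul, smul_add, smul_comm]

lemma facesRight_succ {P Q d : ℕ} (h : P + Q = d + 2) :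
    facesRight (P + 1) (Q + 1) (d + 1) =
      tupleSnoc (P, Q) (d + 1) (-(-1 : ℤ) ^ Q • (facesRight P (Q + 1) d -
        (-1 : ℤ) ^ Q • shuffle P Q d) + facesRight (P + 1) Q d) +
        (-1 : ℤ) ^ Q • shuffle (P + 1) Q (d + 1) := by
  have h1 : facesRight P (Q + 1) d - (-1 : ℤ) ^ Q • shuffle P Q d =
      ∑ b ∈ Finset.range Q, (-1 : ℤ) ^ b • skipRight b d (shuffle P Q d) := by
    rw [facesRight, Finset.sum_range_succ, Nat.add_sub_cancel, skipRight_shuffle_self,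
      add_sub_cancel_right]
  rw [h1, facesRight, Finset.sum_range_succ, Nat.add_sub_cancel, skipRight_shuffle_self]
  congr 1
  rw [facesRight, Finset.smul_sum, ← Finset.sum_add_distrib, map_sum]
  refine Finset.sum_congr rfl fun b hb => ?_
  obtain ⟨Q, rfl⟩ : ∃ Q', Q = Q' + 1 := ⟨Q - 1, by have := Finset.mem_range.mp hb; omega⟩
  rw [skipRight_shuffle_succ (by omega) (by have := Finset.mem_range.mp hb; omega),
    Nat.add_sub_cancel, ← map_smul, smul_add, smul_comm, pow_succ, mul_neg_one, neg_neg]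

lemma shuffle_one_one : shuffle 1 1 0 = Finsupp.single (fun _ => (0, 0)) 1 := by
  have : gridPaths 1 1 0 = {fun _ => (0, 0)} := by
    ext F
    simp only [mem_gridPaths, Finset.mem_singleton]
    constructor
    · rintro ⟨h, _⟩
      funext t
      have := h t
      ext <;> simp <;> omega
    · rintro rfl
      refine ⟨by simp, fun a b hab => ?_⟩
      rw [Fin.lt_def] at hab
      omega
  rw [shuffle, this, Finset.sum_singleton]
  simp [pathArea]

/-- The Leibniz rule for the shuffle product. By induction on the dimension: the last vertex `v` of
all lattice paths is split off, and the faces containing `v` are treated by the induction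
hypothesis, up to the two corners at `v`, which cancel. -/
theorem tupleBoundary_shuffle (d : ℕ) : ∀ P Q : ℕ, P + Q = d + 3 →
    tupleBoundary (d + 1) (shuffle P Q (d + 1)) =
      facesLeft P Q d - (-1 : ℤ) ^ P • facesRight P Q d := by
  induction d with
  | zero =>
    intro P Q h
    have hP : P = 0 ∨ P = 1 ∨ P = 2 ∨ P = 3 := by omega
    have h0 : ∀ v : ℕ × ℕ, tupleSnoc v 0 (tupleBoundary 0 (shuffle 1 1 0)) =
        Finsupp.single (fun _ => v) 1 := by
      intro v
      rw [shuffle_one_one, tupleBoundary_single, Fin.sum_univ_succ, Fin.sum_univ_zero, add_zero,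
        Fin.val_zero, pow_zero, one_smul, tupleSnoc_single]
      congr 1
    rcases hP with rfl | rfl | rfl | rfl
    · simp [facesLeft, facesRight]
    · obtain rfl : Q = 2 := by omega
      rw [shuffle_succ (by omega), shuffle_zero_left, smul_zero, zero_add (shuffle _ _ _),
        tupleBoundary_tupleSnoc, h0, facesLeft, facesRight]
      simp only [Finset.sum_range_succ, Finset.sum_range_zero, Nat.sub_self, shuffle_zero_left]
      rw [shuffle_one_one, skipRight, skipRight, tupleMap_single, tupleMap_single]
      simp [skip, Function.comp_def, add_comm]
    · obtain rfl : Q = 1 := by omega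
      rw [shuffle_succ (by omega), shuffle_zero_right, add_zero, pow_zero, one_smul,
        tupleBoundary_tupleSnoc, h0, facesLeft, facesRight]
      simp only [Finset.sum_range_succ, Finset.sum_range_zero, Nat.sub_self, shuffle_zero_right]
      rw [shuffle_one_one, skipLeft, skipLeft, tupleMap_single, tupleMap_single]
      simp [skip, Function.comp_def]
    · obtain rfl : Q = 0 := by omega
      simp [facesLeft, facesRight]
  | succ d ih =>
    intro P Q h
    rcases P with _ | P
    · simp [facesLeft, facesRight]
    rcases Q with _ | Q
    · simp [facesLeft, facesRight]
    rw [shuffle_succ (by omega), tupleBoundary_tupleSnoc, map_add, map_smul, ih _ _ (by omega),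
      ih _ _ (by omega), facesLeft_succ (by omega), facesRight_succ (by omega)]
    obtain rfl : d = P + Q - 2 := by omega
    have hd : (-1 : ℤ) ^ (P + Q - 2 + 1 + 1) = (-1) ^ P * (-1) ^ Q := by
      rw [← pow_add]; congr 1; omega
    have hQ : (-1 : ℤ) ^ Q * (-1) ^ Q = 1 := by rw [← mul_pow]; simp
    rw [hd]
    simp only [map_add, map_sub, map_smul, pow_succ]
    linear_combination (norm := module) ((-1 : ℤ) ^ P * hQ) • shuffle P (Q + 1) (P + Q - 2 + 1) -
      ((-1 : ℤ) ^ P * hQ) • tupleSnoc (P, Q) (P + Q - 2 + 1) (shuffle P Q (P + Q - 2))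

end Shuffle

/-! ### Products of affine simplices with labelled vertices -/

section Labelled

/-- The affine map of simplices given by a map of vertex labels. -/
def labelMap {α β : Type} [Fintype α] [Fintype β] (h : α → β) :
    C(stdSimplex ℝ α, stdSimplex ℝ β) :=
  ⟨stdSimplex.map h, stdSimplex.continuous_map h⟩

lemma labelMap_comp {α β γ : Type} [Fintype α] [Fintype β] [Fintype γ] (g : β → γ) (f : α → β) :
    (labelMap g).comp (labelMap f) = labelMap (g ∘ f) := by
  ext1 x
  exact stdSimplex.map_comp_apply f g x

lemma pushChain_single {X Y : Type} [TopologicalSpace X] [TopologicalSpace Y] (g : C(X, Y)) (d : ℕ)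
    (σ : C(stdSimplex ℝ (Fin (d + 1)), X)) (k : ℤ) :
    pushChain g d (Finsupp.single σ k) = Finsupp.single (g.comp σ) k := by
  simp [pushChain]

lemma singularBoundary_single {X : Type} [TopologicalSpace X] (d : ℕ)
    (σ : C(stdSimplex ℝ (Fin (d + 2)), X)) (k : ℤ) :
    singularBoundary d (Finsupp.single σ k) = ∑ j : Fin (d + 2),
      (-1 : ℤ) ^ (j : ℕ) • Finsupp.single (σ.comp (simplexMap j.succAbove)) k := by
  simp [singularBoundary, LinearMap.sum_apply]

lemma pushChain_pushChain {X Y Z : Type} [TopologicalSpace X] [TopologicalSpace Y]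
    [TopologicalSpace Z] (g : C(Y, Z)) (f : C(X, Y)) (d : ℕ) (c : SingularChain X d) :
    pushChain g d (pushChain f d c) = pushChain (g.comp f) d c := by
  induction c using Finsupp.induction_linear with
  | zero => simp
  | add f g hf hg => simp only [map_add, hf, hg]
  | single σ k => simp only [pushChain_single, ContinuousMap.comp_assoc]

lemma singularBoundary_pushChain {X Y : Type} [TopologicalSpace X] [TopologicalSpace Y]
    (g : C(X, Y)) (d : ℕ) (c : SingularChain X (d + 1)) :
    singularBoundary d (pushChain g (d + 1) c) = pushChain g d (singularBoundary d c) := by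
  induction c using Finsupp.induction_linear with
  | zero => simp
  | add f g hf hg => simp only [map_add, hf, hg]
  | single σ k =>
    simp only [pushChain_single, singularBoundary_single, map_sum, map_smul,
      ContinuousMap.comp_assoc]

variable {α β : Type} [Fintype α] [Fintype β]

/-- The affine simplices in a product of two simplices whose vertices are given by tuples of grid
points, where the columns and the rows of the grid are labelled by vertices of the factors. -/
def gridChain (h₁ : ℕ → α) (h₂ : ℕ → β) (d : ℕ) :
    TupleChain (ℕ × ℕ) (d + 1) →ₗ[ℤ] SingularChain (stdSimplex ℝ α × stdSimplex ℝ β) d :=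
  Finsupp.lmapDomain ℤ ℤ fun F =>
    (labelMap fun t => h₁ (F t).1).prodMk (labelMap fun t => h₂ (F t).2)

lemma gridChain_single (h₁ : ℕ → α) (h₂ : ℕ → β) (d : ℕ) (F : Fin (d + 1) → ℕ × ℕ) (k : ℤ) :
    gridChain h₁ h₂ d (Finsupp.single F k) = Finsupp.single
      ((labelMap fun t => h₁ (F t).1).prodMk (labelMap fun t => h₂ (F t).2)) k := by
  simp [gridChain]

lemma singularBoundary_gridChain (h₁ : ℕ → α) (h₂ : ℕ → β) (d : ℕ)
    (c : TupleChain (ℕ × ℕ) (d + 2)) :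
    singularBoundary d (gridChain h₁ h₂ (d + 1) c) =
      gridChain h₁ h₂ d (tupleBoundary (d + 1) c) := by
  induction c using Finsupp.induction_linear with
  | zero => simp
  | add f g hf hg => simp only [map_add, hf, hg]
  | single F k =>
    simp only [gridChain_single, singularBoundary_single, tupleBoundary_single, map_sum, map_smul]
    refine Finset.sum_congr rfl fun j _ => ?_
    congr 2
    rw [show simplexMap j.succAbove = labelMap j.succAbove from rfl]
    ext1 x
    exact Prod.ext (DFunLike.congr_fun (labelMap_comp (fun t => h₁ (F t).1) j.succAbove) x)
      (DFunLike.congr_fun (labelMap_comp (fun t => h₂ (F t).2) j.succAbove) x)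

lemma gridChain_skipLeft (h₁ : ℕ → α) (h₂ : ℕ → β) (a d : ℕ) (c : TupleChain (ℕ × ℕ) (d + 1)) :
    gridChain h₁ h₂ d (skipLeft a d c) = gridChain (h₁ ∘ skip a) h₂ d c := by
  induction c using Finsupp.induction_linear with
  | zero => simp
  | add f g hf hg => simp only [map_add, hf, hg]
  | single F k => rw [skipLeft, tupleMap_single, gridChain_single, gridChain_single]; rfl

lemma gridChain_skipRight (h₁ : ℕ → α) (h₂ : ℕ → β) (b d : ℕ) (c : TupleChain (ℕ × ℕ) (d + 1)) :
    gridChain h₁ h₂ d (skipRight b d c) = gridChain h₁ (h₂ ∘ skip b) d c := by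
  induction c using Finsupp.induction_linear with
  | zero => simp
  | add f g hf hg => simp only [map_add, hf, hg]
  | single F k => rw [skipRight, tupleMap_single, gridChain_single, gridChain_single]; rfl

/-- The map of a product of two standard simplices to a product of two simplices with labelled
vertices, given by sequences of vertex labels. -/
def labelProd (p q : ℕ) (h₁ : ℕ → α) (h₂ : ℕ → β) :
    C(stdSimplex ℝ (Fin (p + 1)) × stdSimplex ℝ (Fin (q + 1)), stdSimplex ℝ α × stdSimplex ℝ β) :=
  (labelMap fun a : Fin (p + 1) => h₁ a).prodMap (labelMap fun b : Fin (q + 1) => h₂ b)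

lemma pushChain_productChain (p q d : ℕ) (h₁ : ℕ → α) (h₂ : ℕ → β) :
    pushChain (labelProd p q h₁ h₂) d (productChain p q d) =
      gridChain h₁ h₂ d (shuffle (p + 1) (q + 1) d) := by
  classical
  rw [productChain, shuffle, map_sum, map_sum]
  refine Finset.sum_bij (fun f _ t => (((f.1 t).1 : ℕ), ((f.1 t).2 : ℕ))) ?_ ?_ ?_ ?_
  · intro f _
    refine mem_gridPaths.mpr ⟨fun t => ⟨(f.1 t).1.2, (f.1 t).2.2⟩, fun s t hst => ?_⟩
    have := f.2 hst
    rw [Prod.lt_iff] at this ⊢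
    exact this
  · intro f _ g _ hfg
    ext t
    · exact congrArg Prod.fst (congrFun hfg t)
    · exact congrArg Prod.snd (congrFun hfg t)
  · intro F hF
    rw [mem_gridPaths] at hF
    refine ⟨⟨fun t => (⟨(F t).1, (hF.1 t).1⟩, ⟨(F t).2, (hF.1 t).2⟩), fun s t hst => ?_⟩,
      Finset.mem_univ _, rfl⟩
    have := hF.2 hst
    rw [Prod.lt_iff] at this ⊢
    exact this
  · intro f _
    rw [map_smul, map_smul, pushChain_single, gridChain_single]
    congr 2
    ext1 x
    exact Prod.ext
      (DFunLike.congr_fun (labelMap_comp (fun a : Fin (p + 1) => h₁ a) fun t => (f.1 t).1) x)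
      (DFunLike.congr_fun (labelMap_comp (fun b : Fin (q + 1) => h₂ b) fun t => (f.1 t).2) x)

/-- The Leibniz rule for the product of two simplices. A factor of dimension `0` has no faces, as
`shuffle` vanishes when one factor has no vertices. -/
theorem singularBoundary_gridChain_shuffle {p q d : ℕ} (hd : p + q = d + 1) (h₁ : ℕ → α)
    (h₂ : ℕ → β) :
    singularBoundary d (gridChain h₁ h₂ (d + 1) (shuffle (p + 1) (q + 1) (d + 1))) =
      ∑ a ∈ Finset.range (p + 1),
        (-1 : ℤ) ^ a • gridChain (h₁ ∘ skip a) h₂ d (shuffle p (q + 1) d) +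
      (-1 : ℤ) ^ p • ∑ b ∈ Finset.range (q + 1),
        (-1 : ℤ) ^ b • gridChain h₁ (h₂ ∘ skip b) d (shuffle (p + 1) q d) := by
  rw [singularBoundary_gridChain, tupleBoundary_shuffle d _ _ (by omega), map_sub, map_smul,
    pow_succ, mul_neg_one, neg_smul, sub_neg_eq_add, facesLeft, facesRight, map_sum, map_sum]
  simp only [map_smul, gridChain_skipLeft, gridChain_skipRight, Nat.add_sub_cancel]

end Labelled

/-! ### Barycentric coordinates on chains of sets -/

section Barycentric

variable {α : Type} [DecidableEq α]

/-- The barycentre of the vertices in `S`. -/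
def baryVec (S : Finset α) (l : α) : ℝ := if l ∈ S then (S.card : ℝ)⁻¹ else 0

lemma baryVec_nonneg (S : Finset α) (l : α) : 0 ≤ baryVec S l := by
  unfold baryVec; split_ifs <;> positivity

lemma baryVec_pos {S : Finset α} {l : α} (h : l ∈ S) : 0 < baryVec S l := by
  rw [baryVec, if_pos h]
  have : 0 < S.card := Finset.card_pos.mpr ⟨l, h⟩
  positivity

lemma baryVec_eq {S : Finset α} {l m : α} (hl : l ∈ S) (hm : m ∈ S) :
    baryVec S l = baryVec S m := by
  rw [baryVec, baryVec, if_pos hl, if_pos hm]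

lemma baryVec_of_notMem {S : Finset α} {l : α} (h : l ∉ S) : baryVec S l = 0 := if_neg h

variable [Fintype α]

/-- The combination of barycentres with weights `u`. -/
def barySum (u : Finset α → ℝ) (l : α) : ℝ := ∑ S, u S * baryVec S l

lemma sum_baryVec {S : Finset α} (h : S.Nonempty) : ∑ l, baryVec S l = 1 := by
  have : (S.card : ℝ) ≠ 0 := by exact_mod_cast h.card_pos.ne'
  simp [baryVec, this]

lemma barySum_nonneg {u : Finset α → ℝ} (hu : ∀ S, 0 ≤ u S) (l : α) : 0 ≤ barySum u l :=
  Finset.sum_nonneg fun S _ => mul_nonneg (hu S) (baryVec_nonneg S l)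

/-- The weights `u` are nonnegative, and the sets of positive weight form a chain of nonempty
sets. -/
structure IsChainWeight (u : Finset α → ℝ) : Prop where
  nonneg : ∀ S, 0 ≤ u S
  nonempty : ∀ S, u S ≠ 0 → S.Nonempty
  total : ∀ S T, u S ≠ 0 → u T ≠ 0 → S ⊆ T ∨ T ⊆ S

namespace IsChainWeight

variable {u : Finset α → ℝ}

lemma barySum_le_iff (hu : IsChainWeight u) (m l : α) :
    barySum u m ≤ barySum u l ↔ ∀ S, u S ≠ 0 → m ∈ S → l ∈ S := by
  -- sets of the chain that separate two points all separate them in the same direction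
  have key : ∀ m l : α, (∀ S, u S ≠ 0 → m ∈ S → l ∈ S) →
      ∀ S, u S * baryVec S m ≤ u S * baryVec S l := by
    intro m l h S
    by_cases h0 : u S = 0
    · simp [h0]
    by_cases hm : m ∈ S
    · rw [baryVec_eq hm (h S h0 hm)]
    · rw [baryVec_of_notMem hm, mul_zero]
      exact mul_nonneg (hu.nonneg S) (baryVec_nonneg S l)
  constructor
  · intro h S h0 hm
    by_contra hl
    refine absurd h (not_le.mpr ?_)
    refine Finset.sum_lt_sum (fun T _ => key l m (fun T hT hlT => ?_) T) ⟨S, Finset.mem_univ _, ?_⟩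
    · rcases hu.total S T h0 hT with h1 | h1
      · exact h1 hm
      · exact absurd (h1 hlT) hl
    · rw [baryVec_of_notMem hl, mul_zero]
      exact mul_pos ((hu.nonneg S).lt_of_ne' h0) (baryVec_pos hm)
  · exact fun h => Finset.sum_le_sum fun S _ => key m l h S

lemma barySum_pos_iff (hu : IsChainWeight u) (m : α) :
    0 < barySum u m ↔ ∃ S, u S ≠ 0 ∧ m ∈ S := by
  constructor
  · intro h
    by_contra! h0
    refine h.ne' (Finset.sum_eq_zero fun S _ => ?_)
    by_cases h1 : u S = 0
    · simp [h1]
    · rw [baryVec_of_notMem (h0 S h1), mul_zero]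
  · rintro ⟨S, h0, hm⟩
    exact Finset.sum_pos' (fun T _ => mul_nonneg (hu.nonneg T) (baryVec_nonneg T m))
      ⟨S, Finset.mem_univ _, mul_pos ((hu.nonneg S).lt_of_ne' h0) (baryVec_pos hm)⟩

/-- Each set of a chain has an element that lies in no smaller set of the chain. -/
lemma exists_generator (hu : IsChainWeight u) {S : Finset α} (hS : u S ≠ 0) :
    ∃ m ∈ S, ∀ T, u T ≠ 0 → m ∈ T → S ⊆ T := by
  classical
  by_contra! h
  have hsub : ∀ m ∈ S, ∃ T ∈ Finset.univ.filter (fun T => u T ≠ 0 ∧ T ⊆ S ∧ ¬ S ⊆ T), m ∈ T := by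
    intro m hm
    obtain ⟨T, hT, hmT, hST⟩ := h m hm
    exact ⟨T, by simpa using ⟨hT, (hu.total S T hS hT).resolve_left hST, hST⟩, hmT⟩
  obtain ⟨m₀, hm₀⟩ := hu.nonempty S hS
  obtain ⟨T₀, hT₀, -⟩ := hsub m₀ hm₀
  obtain ⟨T, hT, hmax⟩ := Finset.exists_max_image _ Finset.card ⟨T₀, hT₀⟩
  simp only [Finset.mem_filter, Finset.mem_univ, true_and] at hT hmax
  obtain ⟨m, hmS, hmT⟩ := Finset.not_subset.mp hT.2.2
  obtain ⟨T', hT', hmT'⟩ := hsub m hmS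
  simp only [Finset.mem_filter, Finset.mem_univ, true_and] at hT'
  rcases hu.total T T' hT.1 hT'.1 with h1 | h1
  · exact hmT (Finset.eq_of_subset_of_card_le h1 (hmax T' hT') ▸ hmT')
  · exact hmT (h1 hmT')

/-- The sets of positive weight are the superlevel sets of the coordinates. -/
lemma ne_zero_iff (hu : IsChainWeight u) (S : Finset α) :
    u S ≠ 0 ↔ ∃ m, 0 < barySum u m ∧ ∀ l, l ∈ S ↔ barySum u m ≤ barySum u l := by
  classical
  constructor
  · intro hS
    obtain ⟨m, hm, hmin⟩ := hu.exists_generator hS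
    refine ⟨m, (hu.barySum_pos_iff m).mpr ⟨S, hS, hm⟩, fun l => ?_⟩
    rw [hu.barySum_le_iff]
    exact ⟨fun hl T hT hmT => hmin T hT hmT hl, fun h => h S hS hm⟩
  · rintro ⟨m, hpos, hS⟩
    obtain ⟨T₀, hT₀, hmT₀⟩ := (hu.barySum_pos_iff m).mp hpos
    obtain ⟨T, hT, hmin⟩ := Finset.exists_min_image
      (Finset.univ.filter fun T => u T ≠ 0 ∧ m ∈ T) Finset.card ⟨T₀, by simp [hT₀, hmT₀]⟩
    simp only [Finset.mem_filter, Finset.mem_univ, true_and] at hT hmin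
    suffices S = T by rw [this]; exact hT.1
    ext l
    rw [hS, hu.barySum_le_iff]
    refine ⟨fun h => h T hT.1 hT.2, fun hl T' hT' hmT' => ?_⟩
    rcases hu.total T T' hT.1 hT' with h1 | h1
    · exact h1 hl
    · exact Finset.eq_of_subset_of_card_le h1 (hmin T' ⟨hT', hmT'⟩) ▸ hl

/-- A point is a combination of barycentres of a chain of sets in only one way: the simplices of
the barycentric subdivision fit together. -/
theorem eq_of_barySum_eq (hu : IsChainWeight u) {u' : Finset α → ℝ} (hu' : IsChainWeight u')
    (h : barySum u = barySum u') : u = u' := by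
  classical
  have hsupp : ∀ S, u S ≠ 0 ↔ u' S ≠ 0 := fun S => by rw [hu.ne_zero_iff, hu'.ne_zero_iff, h]
  by_contra hne
  obtain ⟨S₀, hS₀⟩ := Function.ne_iff.mp hne
  obtain ⟨S, hS, hmax⟩ := Finset.exists_max_image
    (Finset.univ.filter fun S => u S ≠ u' S) Finset.card ⟨S₀, by simpa using hS₀⟩
  simp only [Finset.mem_filter, Finset.mem_univ, true_and] at hS hmax
  have hS0 : u S ≠ 0 := fun h0 => hS (by rw [h0, not_not.mp (mt (hsupp S).mpr (not_not.mpr h0))])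
  obtain ⟨m, hm, hmin⟩ := hu.exists_generator hS0
  have hz : ∑ T, (u T - u' T) * baryVec T m = 0 := by
    have := congrFun h m
    simp only [barySum] at this
    simp only [sub_mul, Finset.sum_sub_distrib, this, sub_self]
  rw [Finset.sum_eq_single S] at hz
  · rcases mul_eq_zero.mp hz with h1 | h1
    · exact hS (sub_eq_zero.mp h1)
    · exact (baryVec_pos hm).ne' h1
  · intro T _ hTS
    by_cases hmT : m ∈ T
    · have hT : u T = u' T := by
        by_contra hT
        have hT0 : u T ≠ 0 := fun h0 =>
          hT (by rw [h0, not_not.mp (mt (hsupp T).mpr (not_not.mpr h0))])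
        exact hTS (Finset.eq_of_subset_of_card_le (hmin T hT0 hmT) (hmax T hT)).symm
      rw [hT, sub_self, zero_mul]
    · rw [baryVec_of_notMem hmT, mul_zero]
  · simp

end IsChainWeight

end Barycentric

/-! ### Coordinates on the cells -/

section Coordinates

variable {n : ℕ}

/-- The label of the vertex of a cell in the direction `± v_j`. -/
def labelJ (j : Fin (n + 1)) : Fin (n + 3) := j.castSucc.castSucc

/-- The label of the vertex of a cell in the direction `± v`. -/
def labelV (n : ℕ) : Fin (n + 3) := (Fin.last (n + 1)).castSucc

/-- The label of the vertex of a cell at the origin. -/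
def labelO (n : ℕ) : Fin (n + 3) := Fin.last (n + 2)

lemma sum_labels {M : Type} [AddCommMonoid M] (f : Fin (n + 3) → M) :
    ∑ x, f x = ∑ j, f (labelJ j) + f (labelV n) + f (labelO n) := by
  rw [Fin.sum_univ_castSucc, Fin.sum_univ_castSucc]
  rfl

lemma forall_labels {P : Fin (n + 3) → Prop} :
    (∀ x, P x) ↔ (∀ j, P (labelJ j)) ∧ P (labelV n) ∧ P (labelO n) := by
  refine ⟨fun h => ⟨fun j => h _, h _, h _⟩, fun ⟨h1, h2, h3⟩ x => ?_⟩
  refine Fin.lastCases h3 (fun x => ?_) x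
  exact Fin.lastCases h2 h1 x

/-- The signs of the vertices of the first simplex factor of `e_i^τ`: the factor has a vertex in
each direction `v_j` for `j ∈ J_≥`, `-v_j` for `j ∈ J_≤` and `τ v` (if `τ ≠ 0`), and a vertex at the
origin if `≺` is `≤`. -/
def Idx.signs (i : Idx n) (τ : SignType) : Fin (n + 3) → SignType :=
  Fin.snoc (α := fun _ => SignType) (Fin.snoc (α := fun _ => SignType)
    (fun j => if j ∈ i.Jge then 1 else if j ∈ i.Jle then -1 else 0) τ)
    (match i.prec with | .le => 1 | .eq => 0)

lemma Idx.signs_labelJ (i : Idx n) (τ : SignType) (j : Fin (n + 1)) :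
    i.signs τ (labelJ j) = if j ∈ i.Jge then 1 else if j ∈ i.Jle then -1 else 0 := by
  simp [Idx.signs, labelJ]

lemma Idx.signs_labelV (i : Idx n) (τ : SignType) : i.signs τ (labelV n) = τ := by
  simp [Idx.signs, labelV]

lemma Idx.signs_labelO (i : Idx n) (τ : SignType) :
    i.signs τ (labelO n) = match i.prec with | .le => 1 | .eq => 0 := by
  simp [Idx.signs, labelO]

lemma Idx.signs_labelJ_ne_zero (i : Idx n) (τ : SignType) (j : Fin (n + 1)) :
    i.signs τ (labelJ j) ≠ 0 ↔ j ∈ i.J := by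
  rw [Idx.signs_labelJ, Idx.J, Finset.mem_union]
  split_ifs <;> simp_all

lemma Idx.signs_labelO_ne_zero (i : Idx n) (τ : SignType) :
    i.signs τ (labelO n) ≠ 0 ↔ i.prec = .le := by
  rw [Idx.signs_labelO]
  cases i.prec <;> simp

/-- The vector `W_v v + ∑ W_j v_j`, in coordinates. -/
def dirVec (W : Fin (n + 3) → ℝ) (l : Fin (n + 1)) : ℝ :=
  W (labelV n) + ∑ j, W (labelJ j) - W (labelJ l)

lemma dirVec_eq (W : Fin (n + 3) → ℝ) :
    dirVec W = W (labelV n) • vecV n + ∑ j, W (labelJ j) • vecVj j := by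
  funext l
  simp only [dirVec, vecV, vecVj, Pi.add_apply, Pi.smul_apply, Finset.sum_apply, Pi.sub_apply,
    smul_eq_mul, mul_one, mul_sub, Finset.sum_sub_distrib, Pi.single_apply, mul_ite, mul_zero,
    Finset.sum_ite_eq, Finset.mem_univ, if_true]
  ring

lemma dirVec_smul (a : ℝ) (W : Fin (n + 3) → ℝ) (l : Fin (n + 1)) :
    dirVec (fun x => a * W x) l = a * dirVec W l := by
  simp only [dirVec, ← Finset.mul_sum]
  ring

/-- The vectors `v` and `v_j` for `j ≠ l` are linearly independent. -/
lemma eq_of_dirVec_eq {W W' : Fin (n + 3) → ℝ} (h : dirVec W = dirVec W') {l : Fin (n + 1)}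
    (hl : W (labelJ l) = 0) (hl' : W' (labelJ l) = 0) :
    (∀ j, W (labelJ j) = W' (labelJ j)) ∧ W (labelV n) = W' (labelV n) := by
  have h1 : ∀ j, W (labelJ j) = W' (labelJ j) := by
    intro j
    have h2 := congrFun h l
    have h3 := congrFun h j
    simp only [dirVec, hl, hl'] at h2 h3
    linarith
  refine ⟨h1, ?_⟩
  have h2 := congrFun h l
  simp only [dirVec, h1] at h2
  linarith

/-- The norm of `(W_v v + ∑ W_j v_j, W_o)`. -/
def weightNorm (W : Fin (n + 3) → ℝ) : ℝ :=
  Real.sqrt (∑ l, dirVec W l ^ 2 + W (labelO n) ^ 2)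

lemma weightNorm_sq (W : Fin (n + 3) → ℝ) :
    weightNorm W ^ 2 = ∑ l, dirVec W l ^ 2 + W (labelO n) ^ 2 :=
  Real.sq_sqrt (by positivity)

lemma eq_zero_of_dirVec_eq_zero {W : Fin (n + 3) → ℝ} (h : ∑ l, dirVec W l ^ 2 = 0)
    {l : Fin (n + 1)} (hl : W (labelJ l) = 0) :
    (∀ j, W (labelJ j) = 0) ∧ W (labelV n) = 0 := by
  have h0 : dirVec W = dirVec (0 : Fin (n + 3) → ℝ) := by
    funext l
    rw [Finset.sum_eq_zero_iff_of_nonneg fun _ _ => sq_nonneg _] at h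
    have := pow_eq_zero_iff (two_ne_zero) |>.mp (h l (Finset.mem_univ _))
    simpa [dirVec] using this
  simpa using eq_of_dirVec_eq h0 hl rfl

lemma weightNorm_pos {W : Fin (n + 3) → ℝ} (hW : W ≠ 0) {l : Fin (n + 1)}
    (hl : W (labelJ l) = 0) : 0 < weightNorm W := by
  refine Real.sqrt_pos.mpr (lt_of_le_of_ne (by positivity) fun h => hW ?_)
  have h1 : 0 ≤ ∑ l, dirVec W l ^ 2 := by positivity
  have h2 : 0 ≤ W (labelO n) ^ 2 := sq_nonneg _
  obtain ⟨h3, h4⟩ := eq_zero_of_dirVec_eq_zero (by linarith) hl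
  funext x
  revert x
  exact forall_labels.mpr ⟨h3, h4, pow_eq_zero_iff two_ne_zero |>.mp (by linarith)⟩

/-- The radius of the sphere around `0` of those `x` with `x + i y ∈ Y` and `(z - a_m)² = 1`, where
`m` is a position of a largest coordinate of `y`. -/
def radius (y : Fin (n + 1) → ℝ) : ℝ :=
  Real.sqrt (2 + ∑ l, y l ^ 2 - 2 * Finset.univ.sup' Finset.univ_nonempty y)

/-- The point of `Y` with signed weights `W` on the vertices in the real directions and weights `u`
on the barycentres in the imaginary directions. -/
def weightPoint (W : Fin (n + 3) → ℝ) (u : Finset (Fin (n + 1)) → ℝ) (l : Fin (n + 1)) : ℂ :=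
  ⟨radius (barySum u) / weightNorm W * dirVec W l, barySum u l⟩

@[simp] lemma weightPoint_re (W : Fin (n + 3) → ℝ) (u : Finset (Fin (n + 1)) → ℝ)
    (l : Fin (n + 1)) :
    (weightPoint W u l).re = radius (barySum u) / weightNorm W * dirVec W l := rfl

@[simp] lemma weightPoint_im (W : Fin (n + 3) → ℝ) (u : Finset (Fin (n + 1)) → ℝ)
    (l : Fin (n + 1)) : (weightPoint W u l).im = barySum u l := rfl

/-- The weights `u` describe a point of the simplex spanned by the members of the list `L`. -/
structure IsListWeight {α : Type} [Fintype α] (L : List α) (u : α → ℝ) : Prop where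
  nonneg : ∀ S, 0 ≤ u S
  sum_eq : ∑ S, u S = 1
  support : ∀ S, S ∉ L → u S = 0

/-- The signed weights `W` describe a point of the simplex whose vertices have the signs `σ`. -/
structure IsSignWeight (σ : Fin (n + 3) → SignType) (W : Fin (n + 3) → ℝ) : Prop where
  sign : ∀ x, W x = (σ x : ℝ) * |W x|
  sum_eq : ∑ x, |W x| = 1

end Coordinates

section Parametrization

variable {n : ℕ}

lemma IsListWeight.convex {α : Type} [Fintype α] (L : List α) :
    Convex ℝ {u : α → ℝ | IsListWeight L u} := by
  intro u hu u' hu' a b ha hb hab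
  refine ⟨fun S => ?_, ?_, fun S hS => ?_⟩
  · exact add_nonneg (mul_nonneg ha (hu.nonneg S)) (mul_nonneg hb (hu'.nonneg S))
  · simp only [Pi.add_apply, Pi.smul_apply, smul_eq_mul, Finset.sum_add_distrib, ← Finset.mul_sum,
      hu.sum_eq, hu'.sum_eq, mul_one, hab]
  · simp [hu.support S hS, hu'.support S hS]

lemma center_apply (S : Finset (Fin (n + 1))) (l : Fin (n + 1)) :
    center S l = Complex.I * (baryVec S l : ℂ) := by
  rw [center, baryVec]
  split_ifs <;> simp [div_eq_mul_inv]

/-- The points `i y` of the simplex spanned by the centres of a list of sets. -/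
lemma mem_convexHull_center (L : List (Finset (Fin (n + 1)))) (y : Fin (n + 1) → ℝ) :
    (fun l => Complex.I * (y l : ℂ)) ∈ convexHull ℝ (center '' {S | S ∈ L}) ↔
      ∃ u, IsListWeight L u ∧ y = barySum u := by
  classical
  constructor
  · intro h
    have hsub : convexHull ℝ (center '' {S | S ∈ L}) ⊆ {f : Fin (n + 1) → ℂ |
        ∃ u, IsListWeight L u ∧ f = fun l => Complex.I * (barySum u l : ℂ)} := by
      refine convexHull_min ?_ ?_
      · rintro _ ⟨S, hS, rfl⟩
        refine ⟨Pi.single S 1, ⟨fun T => ?_, by simp, fun T hT => ?_⟩, ?_⟩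
        · rw [Pi.single_apply]; split_ifs <;> norm_num
        · rw [Pi.single_apply, if_neg]
          rintro rfl
          exact hT hS
        · funext l
          rw [center_apply]
          simp [barySum, Pi.single_apply]
      · rintro _ ⟨u, hu, rfl⟩ _ ⟨u', hu', rfl⟩ a b ha hb hab
        refine ⟨a • u + b • u', IsListWeight.convex L hu hu' ha hb hab, ?_⟩
        funext l
        have : barySum (a • u + b • u') l = a * barySum u l + b * barySum u' l := by
          simp only [barySum, Pi.add_apply, Pi.smul_apply, smul_eq_mul, add_mul,
            Finset.sum_add_distrib, Finset.mul_sum, mul_assoc]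
        rw [this]
        simp only [Pi.add_apply, Pi.smul_apply, Complex.real_smul, Complex.ofReal_add,
          Complex.ofReal_mul]
        ring
    obtain ⟨u, hu, huy⟩ := hsub h
    refine ⟨u, hu, funext fun l => ?_⟩
    have := mul_left_cancel₀ Complex.I_ne_zero (congrFun huy l)
    exact_mod_cast this
  · rintro ⟨u, hu, rfl⟩
    have : (fun l => Complex.I * (barySum u l : ℂ)) =
        ∑ S ∈ Finset.univ.filter (· ∈ L), u S • center S := by
      rw [Finset.sum_filter_of_ne]
      · funext l
        simp only [barySum, Finset.sum_apply, Pi.smul_apply, center_apply, Complex.real_smul,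
          Complex.ofReal_sum, Complex.ofReal_mul, Finset.mul_sum]
        exact Finset.sum_congr rfl fun S _ => by ring
      · intro S _ h
        by_contra hS
        exact h (by rw [hu.support S hS, zero_smul])
    rw [this]
    refine (convex_convexHull ℝ _).sum_mem (fun S _ => hu.nonneg S) ?_ fun S hS => ?_
    · rw [← hu.sum_eq]
      refine Finset.sum_filter_of_ne fun S _ h => ?_
      by_contra hS
      exact h (hu.support S hS)
    · exact subset_convexHull ℝ _ ⟨S, by simpa using hS, rfl⟩

lemma IsSignWeight.ne_zero {σ : Fin (n + 3) → SignType} {W : Fin (n + 3) → ℝ}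
    (hW : IsSignWeight σ W) : W ≠ 0 := by
  rintro rfl
  simpa using hW.sum_eq

lemma IsSignWeight.eq_zero {σ : Fin (n + 3) → SignType} {W : Fin (n + 3) → ℝ}
    (hW : IsSignWeight σ W) {x : Fin (n + 3)} (hx : σ x = 0) : W x = 0 := by
  rw [hW.sign, hx]; simp

lemma Idx.head_subset (i : Idx n) {S : Finset (Fin (n + 1))} (hS : S ∈ i.chain) :
    i.chain.head i.chain_ne_nil ⊆ S := by
  have h := i.strict
  rw [← List.cons_head_tail i.chain_ne_nil] at hS h
  rcases List.mem_cons.mp hS with h1 | h1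
  · exact h1.ge
  · exact ((List.pairwise_cons.mp h).1 S h1).subset

lemma Idx.minHead_mem (i : Idx n) {S : Finset (Fin (n + 1))} (hS : S ∈ i.chain) :
    i.minHead ∈ S :=
  i.head_subset hS (Finset.min'_mem _ _)

lemma Idx.notMem_J (i : Idx n) {S : Finset (Fin (n + 1))} (hS : S ∈ i.chain) {l : Fin (n + 1)}
    (hl : l ∈ S) : l ∉ i.J := by
  have := i.subset_getLast hS hl
  rw [Idx.J, Finset.mem_union, not_or]
  exact ⟨fun h => Finset.disjoint_left.mp i.Jle_disjoint h this,
    fun h => Finset.disjoint_left.mp i.Jge_disjoint h this⟩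

lemma Idx.signs_eq_zero (i : Idx n) (τ : SignType) {S : Finset (Fin (n + 1))} (hS : S ∈ i.chain)
    {l : Fin (n + 1)} (hl : l ∈ S) : i.signs τ (labelJ l) = 0 := by
  by_contra h
  exact i.notMem_J hS hl ((i.signs_labelJ_ne_zero τ l).mp h)

lemma Idx.signs_minHead (i : Idx n) (τ : SignType) : i.signs τ (labelJ i.minHead) = 0 :=
  i.signs_eq_zero τ (List.head_mem i.chain_ne_nil) (Finset.min'_mem _ _)

lemma Idx.isChainWeight (i : Idx n) {u : Finset (Fin (n + 1)) → ℝ}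
    (hu : IsListWeight i.chain u) : IsChainWeight u := by
  have hmem : ∀ S, u S ≠ 0 → S ∈ i.chain := fun S h => by
    by_contra hS; exact h (hu.support S hS)
  refine ⟨hu.nonneg, fun S h => i.nonempty S (hmem S h), fun S T hS hT => ?_⟩
  obtain ⟨a, ha, rfl⟩ := List.getElem_of_mem (hmem S hS)
  obtain ⟨b, hb, rfl⟩ := List.getElem_of_mem (hmem T hT)
  have hp := List.pairwise_iff_getElem.mp i.strict
  rcases lt_trichotomy a b with h | rfl | h
  · exact Or.inl (hp a b ha hb h).subset
  · exact Or.inl subset_rfl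
  · exact Or.inr (hp b a hb ha h).subset

lemma Idx.sum_barySum (i : Idx n) {u : Finset (Fin (n + 1)) → ℝ}
    (hu : IsListWeight i.chain u) : ∑ l, barySum u l = 1 := by
  simp only [barySum]
  rw [Finset.sum_comm, ← hu.sum_eq]
  refine Finset.sum_congr rfl fun S _ => ?_
  rw [← Finset.mul_sum]
  by_cases h : u S = 0
  · rw [h, zero_mul]
  · rw [sum_baryVec ((i.isChainWeight hu).nonempty S h), mul_one]

lemma Idx.barySum_le (i : Idx n) {u : Finset (Fin (n + 1)) → ℝ}
    (hu : IsListWeight i.chain u) (l : Fin (n + 1)) : barySum u l ≤ barySum u i.minHead := by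
  refine ((i.isChainWeight hu).barySum_le_iff _ _).mpr fun S h _ => i.minHead_mem ?_
  by_contra hS
  exact h (hu.support S hS)

/-- On the simplex of a chain, the radius can be computed with the centre `a_{min I_1}`, because
all members of the chain contain `min I_1`. -/
lemma Idx.radius_sq (i : Idx n) {u : Finset (Fin (n + 1)) → ℝ} (hu : IsListWeight i.chain u) :
    0 < radius (barySum u) ∧ radius (barySum u) ^ 2 =
      1 + ∑ l, (barySum u l - if l = i.minHead then 1 else 0) ^ 2 := by
  have hsup : Finset.univ.sup' Finset.univ_nonempty (barySum u) = barySum u i.minHead :=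
    le_antisymm (Finset.sup'_le _ _ fun l _ => i.barySum_le hu l)
      (Finset.le_sup' _ (Finset.mem_univ _))
  have h : 2 + ∑ l, barySum u l ^ 2 - 2 * Finset.univ.sup' Finset.univ_nonempty (barySum u) =
      1 + ∑ l, (barySum u l - if l = i.minHead then 1 else 0) ^ 2 := by
    rw [hsup]
    simp only [sub_sq, Finset.sum_add_distrib, Finset.sum_sub_distrib, mul_ite, mul_one, mul_zero,
      ite_pow, one_pow, ne_eq, OfNat.ofNat_ne_zero, not_false_eq_true, zero_pow,
      Finset.sum_ite_eq', Finset.mem_univ, if_true]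
    ring
  have hpos : 0 < 1 + ∑ l, (barySum u l - if l = i.minHead then 1 else 0) ^ 2 := by positivity
  rw [radius, h]
  exact ⟨Real.sqrt_pos.mpr hpos, Real.sq_sqrt hpos.le⟩

lemma sum_sub_sphereCenter_sq (z : Fin (n + 1) → ℂ) (m : Fin (n + 1)) :
    (∑ l, (z l - sphereCenter m l) ^ 2).re =
        ∑ l, (z l).re ^ 2 - ∑ l, ((z l).im - if l = m then 1 else 0) ^ 2 ∧
      (∑ l, (z l - sphereCenter m l) ^ 2).im =
        2 * ∑ l, (z l).re * ((z l).im - if l = m then 1 else 0) := by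
  have hre : ∀ l, (z l - sphereCenter m l).re = (z l).re := by
    intro l; simp only [sphereCenter, Pi.single_apply]; split_ifs <;> simp
  have him : ∀ l, (z l - sphereCenter m l).im = (z l).im - if l = m then 1 else 0 := by
    intro l; simp only [sphereCenter, Pi.single_apply]; split_ifs <;> simp
  constructor
  · rw [Complex.re_sum, ← Finset.sum_sub_distrib]
    refine Finset.sum_congr rfl fun l _ => ?_
    rw [sq, Complex.mul_re, hre, him]; ring
  · rw [Complex.im_sum, Finset.mul_sum]
    refine Finset.sum_congr rfl fun l _ => ?_
    rw [sq, Complex.mul_im, hre, him]; ring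

/-- The real directions of a cell are orthogonal to `y - e_{min I_1}` for all `y` in the simplex of
its chain. Therefore `(z - a_{min I_1})²` is real on the cell. -/
lemma Idx.dirVec_orthogonal (i : Idx n) {τ : SignType} {W : Fin (n + 3) → ℝ}
    (hW : ∀ x, i.signs τ x = 0 → W x = 0) {u : Finset (Fin (n + 1)) → ℝ}
    (hu : IsListWeight i.chain u) :
    ∑ l, dirVec W l * (barySum u l - if l = i.minHead then 1 else 0) = 0 := by
  have h0 : ∀ l, W (labelJ l) * (barySum u l - if l = i.minHead then 1 else 0) = 0 := by
    intro l
    by_cases hl : i.signs τ (labelJ l) = 0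
    · rw [hW _ hl, zero_mul]
    · have hm : l ≠ i.minHead := by
        rintro rfl
        exact hl (i.signs_minHead τ)
      have hb : barySum u l = 0 := by
        refine le_antisymm (not_lt.mp fun h => ?_) (barySum_nonneg hu.nonneg l)
        obtain ⟨S, hS, hlS⟩ := ((i.isChainWeight hu).barySum_pos_iff l).mp h
        refine hl (i.signs_eq_zero τ (S := S) ?_ hlS)
        by_contra hSi
        exact hS (hu.support S hSi)
      rw [hb, if_neg hm, sub_zero, mul_zero]
  have h1 : ∀ l, dirVec W l * (barySum u l - if l = i.minHead then 1 else 0) =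
      (W (labelV n) + ∑ j, W (labelJ j)) * (barySum u l - if l = i.minHead then 1 else 0) := by
    intro l
    rw [dirVec, sub_mul, h0, sub_zero]
  rw [Finset.sum_congr rfl fun l _ => h1 l, ← Finset.mul_sum, Finset.sum_sub_distrib,
    i.sum_barySum hu]
  simp

/-- For `z = x + i y` with `x` in the cone and `y` in the simplex of a cell, the condition
`(z - a_{min I_1})² ≺ 1` compares `|x|` with the radius at `y`. -/
lemma Idx.holdsOne_iff (i : Idx n) {τ : SignType} {W : Fin (n + 3) → ℝ}
    (hW : ∀ x, i.signs τ x = 0 → W x = 0) {u : Finset (Fin (n + 1)) → ℝ}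
    (hu : IsListWeight i.chain u) {z : Fin (n + 1) → ℂ} (hre : ∀ l, (z l).re = dirVec W l)
    (him : ∀ l, (z l).im = barySum u l) :
    i.prec.holdsOne (∑ l, (z l - sphereCenter i.minHead l) ^ 2) ↔
      ∑ l, dirVec W l ^ 2 ≤ radius (barySum u) ^ 2 ∧
        (i.prec = .eq → ∑ l, dirVec W l ^ 2 = radius (barySum u) ^ 2) := by
  obtain ⟨h1, h2⟩ := sum_sub_sphereCenter_sq z i.minHead
  simp only [hre, him, i.dirVec_orthogonal hW hu, mul_zero] at h1 h2
  rw [(i.radius_sq hu).2]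
  cases i.prec
  · simp only [Prec.holdsOne, h1, h2, true_and, reduceCtorEq, false_implies, and_true]
    constructor <;> intro h <;> linarith
  · simp only [Prec.holdsOne, Complex.ext_iff, h1, h2, Complex.one_re, Complex.one_im, and_true,
      true_implies]
    constructor
    · intro h
      constructor <;> linarith
    · intro h
      linarith [h.2]

/-- Signed weights on the directions of a cell describe the points of its cone. -/
lemma Idx.mem_coneV (i : Idx n) (τ : SignType) (x : Fin (n + 1) → ℝ) :
    x ∈ coneV i.Jle i.Jge τ ↔
      ∃ W : Fin (n + 3) → ℝ, (∀ j, W (labelJ j) = (i.signs τ (labelJ j) : ℝ) * |W (labelJ j)|) ∧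
        W (labelV n) = (τ : ℝ) * |W (labelV n)| ∧ x = dirVec W := by
  have hdisj := i.J_disjoint
  constructor
  · rintro ⟨t, c, ht, hle, hge, rfl⟩
    refine ⟨Fin.snoc (α := fun _ => ℝ) (Fin.snoc (α := fun _ => ℝ)
      (fun j => if j ∈ i.J then c j else 0) (τ * t)) 0, fun j => ?_, ?_, ?_⟩
    · rw [i.signs_labelJ]
      simp only [labelJ, Fin.snoc_castSucc, Idx.J, Finset.mem_union]
      by_cases h1 : j ∈ i.Jge
      · simp [h1, abs_of_nonneg (hge j h1)]
      · by_cases h2 : j ∈ i.Jle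
        · simp [h1, h2, abs_of_nonpos (hle j h2)]
        · simp [h1, h2]
    · simp only [labelV, Fin.snoc_castSucc, Fin.snoc_last, abs_mul, abs_of_nonneg ht]
      cases τ <;> simp
    · rw [dirVec_eq, add_assoc]
      congr 1
      · simp [labelV]
      · rw [← Finset.sum_union hdisj]
        simp only [labelJ, Fin.snoc_castSucc, ite_smul, zero_smul]
        rw [Finset.sum_ite_mem, Finset.univ_inter]
        rfl
  · rintro ⟨W, hJ, hV, rfl⟩
    refine ⟨|W (labelV n)|, fun j => W (labelJ j), abs_nonneg _, fun j hj => ?_, fun j hj => ?_, ?_⟩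
    · have h1 := hJ j
      rw [i.signs_labelJ, if_neg (Finset.disjoint_left.mp hdisj hj), if_pos hj] at h1
      have h2 := abs_nonneg (W (labelJ j))
      simp only [SignType.coe_neg, SignType.coe_one, neg_mul, one_mul] at h1
      linarith
    · have h1 := hJ j
      rw [i.signs_labelJ, if_pos hj] at h1
      have h2 := abs_nonneg (W (labelJ j))
      simp only [SignType.coe_one, one_mul] at h1
      linarith
    · rw [dirVec_eq, ← hV, add_assoc, ← Finset.sum_union hdisj]
      congr 1
      symm
      refine Finset.sum_subset (Finset.subset_univ _) fun j _ hj => ?_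
      have h1 := hJ j
      have h0 : i.signs τ (labelJ j) = 0 := by
        by_contra h
        exact hj ((i.signs_labelJ_ne_zero τ j).mp h)
      rw [h0, SignType.coe_zero, zero_mul] at h1
      simp only [h1, zero_smul]

/-- The cells are parametrized by signed weights on the vertices in the real directions and weights
on the barycentres. -/
theorem Idx.mem_cellSet (i : Idx n) (τ : SignType) (z : Fin (n + 1) → ℂ) :
    z ∈ i.cellSet τ ↔ ∃ W u, IsSignWeight (i.signs τ) W ∧ IsListWeight i.chain u ∧
      z = weightPoint W u := by
  constructor
  · rintro ⟨h1, h2, h3⟩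
    obtain ⟨u, hu, hy⟩ := (mem_convexHull_center i.chain fun l => (z l).im).mp h1
    obtain ⟨W, hJ, hV, hx⟩ := (i.mem_coneV τ _).mp h2
    have hre : ∀ l, (z l).re = dirVec W l := congrFun hx
    have him : ∀ l, (z l).im = barySum u l := congrFun hy
    -- the weight of the origin is the coordinate completing `x` to a vector of norm `radius y`
    set r := radius (barySum u) with hr
    obtain ⟨hr0, -⟩ := i.radius_sq hu
    have hcomp : ∀ W' : Fin (n + 3) → ℝ, (∀ j, W' (labelJ j) = W (labelJ j)) →
        W' (labelV n) = W (labelV n) → dirVec W' = dirVec W := by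
      intro W' h4 h5
      funext l
      simp only [dirVec, h4, h5]
    have hW0 : ∀ x, i.signs τ x = 0 → Function.update W (labelO n) 0 x = 0 := by
      refine forall_labels.mpr ⟨fun j hj => ?_, fun hj => ?_, fun _ => by simp⟩
      · rw [Function.update_of_ne (by simp [labelJ, labelO, Fin.ext_iff]; omega), hJ, hj]; simp
      · rw [i.signs_labelV] at hj
        rw [Function.update_of_ne (by simp [labelV, labelO, Fin.ext_iff]), hV, hj]; simp
    have hD0 : dirVec (Function.update W (labelO n) 0) = dirVec W := by
      refine hcomp _ (fun j => ?_) ?_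
      · rw [Function.update_of_ne (by simp [labelJ, labelO, Fin.ext_iff]; omega)]
      · rw [Function.update_of_ne (by simp [labelV, labelO, Fin.ext_iff])]
    rw [i.holdsOne_iff hW0 hu (by simpa [hD0] using hre) him, hD0, ← hr] at h3
    set b := Real.sqrt (r ^ 2 - ∑ l, dirVec W l ^ 2) with hb
    have hb2 : b ^ 2 = r ^ 2 - ∑ l, dirVec W l ^ 2 := Real.sq_sqrt (by linarith [h3.1])
    set W₁ := Function.update W (labelO n) b with hW₁
    have h1J : ∀ j, W₁ (labelJ j) = W (labelJ j) := fun j =>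
      Function.update_of_ne (by simp [labelJ, labelO, Fin.ext_iff]; omega) _ _
    have h1V : W₁ (labelV n) = W (labelV n) :=
      Function.update_of_ne (by simp [labelV, labelO, Fin.ext_iff]) _ _
    have h1O : W₁ (labelO n) = b := Function.update_self _ _ _
    have hD1 := hcomp W₁ h1J h1V
    have hN1 : weightNorm W₁ = r := by
      rw [weightNorm, hD1, h1O, hb2, add_sub_cancel, Real.sqrt_sq hr0.le]
    set M := ∑ x, |W₁ x| with hM
    have hM0 : 0 < M := by
      refine lt_of_le_of_ne (Finset.sum_nonneg fun _ _ => abs_nonneg _) fun h => ?_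
      have h0 : W₁ = 0 := by
        funext x
        have := (Finset.sum_eq_zero_iff_of_nonneg fun _ _ => abs_nonneg _).mp h.symm x
          (Finset.mem_univ _)
        simpa using this
      rw [h0] at hN1
      simp [weightNorm, dirVec] at hN1
      linarith
    have hsign : ∀ x, W₁ x = (i.signs τ x : ℝ) * |W₁ x| := by
      refine forall_labels.mpr ⟨fun j => ?_, ?_, ?_⟩
      · rw [h1J]; exact hJ j
      · rw [h1V, i.signs_labelV]; exact hV
      · rw [h1O, i.signs_labelO, abs_of_nonneg (Real.sqrt_nonneg _)]
        cases hp : i.prec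
        · simp [hb]
        · have := h3.2 hp
          rw [hb, this]; simp
    refine ⟨fun x => M⁻¹ * W₁ x, u, ⟨fun x => ?_, ?_⟩, hu, ?_⟩
    · rw [abs_mul, abs_of_pos (inv_pos.mpr hM0)]
      nth_rewrite 1 [hsign x]
      ring
    · simp only [abs_mul, abs_of_pos (inv_pos.mpr hM0), ← Finset.mul_sum]
      exact inv_mul_cancel₀ hM0.ne'
    · have hN : weightNorm (fun x => M⁻¹ * W₁ x) = M⁻¹ * r := by
        rw [← hN1, weightNorm, weightNorm]
        simp only [dirVec_smul, mul_pow, ← Finset.mul_sum, ← mul_add]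
        rw [Real.sqrt_mul (sq_nonneg _), Real.sqrt_sq (inv_pos.mpr hM0).le]
      funext l
      apply Complex.ext
      · rw [weightPoint_re, hN, dirVec_smul, hD1, hre, ← hr]
        have : r ≠ 0 := hr0.ne'
        field_simp
      · rw [weightPoint_im, him]
  · rintro ⟨W, u, hW, hu, rfl⟩
    have hN := weightNorm_pos hW.ne_zero (hW.eq_zero (i.signs_minHead τ))
    have hr := (i.radius_sq hu).1
    set a := radius (barySum u) / weightNorm W with ha
    have ha0 : 0 < a := div_pos hr hN
    have hsign : ∀ x, a * W x = (i.signs τ x : ℝ) * |a * W x| := fun x => by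
      rw [abs_mul, abs_of_pos ha0]
      nth_rewrite 1 [hW.sign x]
      ring
    have hre : ∀ l, (weightPoint W u l).re = dirVec (fun x => a * W x) l := fun l => by
      rw [dirVec_smul, weightPoint_re]
    refine ⟨?_, ?_, ?_⟩
    · simp only [weightPoint_im]
      exact (mem_convexHull_center i.chain _).mpr ⟨u, hu, rfl⟩
    · refine (i.mem_coneV τ _).mpr ⟨fun x => a * W x, fun j => hsign _, ?_, funext hre⟩
      have := hsign (labelV n)
      rwa [i.signs_labelV] at this
    · rw [i.holdsOne_iff (fun x hx => by rw [hW.eq_zero hx, mul_zero]) hu hre fun l => rfl]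
      have hsq : ∑ l, dirVec (fun x => a * W x) l ^ 2 =
          radius (barySum u) ^ 2 - a ^ 2 * W (labelO n) ^ 2 := by
        simp only [dirVec_smul, mul_pow, ← Finset.mul_sum]
        have := weightNorm_sq W
        rw [eq_sub_iff_add_eq, ← mul_add, ← this, ha, div_pow,
          div_mul_cancel₀ _ (pow_ne_zero 2 hN.ne')]
      rw [hsq]
      refine ⟨by have : 0 ≤ a ^ 2 * W (labelO n) ^ 2 := by positivity
                 linarith, fun hp => ?_⟩
      rw [hW.eq_zero (x := labelO n) (by rw [i.signs_labelO, hp])]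
      ring

/-- A point determines its weights, simultaneously for all cells: this is both the injectivity of
the parametrizations and the disjointness of the open cells. -/
theorem Idx.weights_unique (i i' : Idx n) (τ τ' : SignType) {W W' : Fin (n + 3) → ℝ}
    {u u' : Finset (Fin (n + 1)) → ℝ} (hW : IsSignWeight (i.signs τ) W)
    (hW' : IsSignWeight (i'.signs τ') W') (hu : IsListWeight i.chain u)
    (hu' : IsListWeight i'.chain u') (h : weightPoint W u = weightPoint W' u') :
    W = W' ∧ u = u' := by
  have hy : barySum u = barySum u' := funext fun l => congrArg Complex.im (congrFun h l)
  have huu := (i.isChainWeight hu).eq_of_barySum_eq (i'.isChainWeight hu') hy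
  refine ⟨?_, huu⟩
  subst huu
  obtain ⟨S, hS⟩ : ∃ S, u S ≠ 0 := by
    by_contra! h0
    have := hu.sum_eq
    simp [h0] at this
  have hSi : S ∈ i.chain := by by_contra h0; exact hS (hu.support S h0)
  have hSi' : S ∈ i'.chain := by by_contra h0; exact hS (hu'.support S h0)
  obtain ⟨l, hl⟩ := i.nonempty S hSi
  have hWl := hW.eq_zero (i.signs_eq_zero τ hSi hl)
  have hWl' := hW'.eq_zero (i'.signs_eq_zero τ' hSi' hl)
  have hN := weightNorm_pos hW.ne_zero hWl
  have hN' := weightNorm_pos hW'.ne_zero hWl'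
  have hr := (i.radius_sq hu).1
  set a := (weightNorm W)⁻¹ with ha
  set a' := (weightNorm W')⁻¹ with ha'
  have ha0 : 0 < a := inv_pos.mpr hN
  have ha0' : 0 < a' := inv_pos.mpr hN'
  have hD : dirVec (fun x => a * W x) = dirVec (fun x => a' * W' x) := by
    funext l
    have := congrArg Complex.re (congrFun h l)
    rw [weightPoint_re, weightPoint_re, div_eq_mul_inv, div_eq_mul_inv, mul_assoc, mul_assoc,
      ← ha, ← ha'] at this
    rw [dirVec_smul, dirVec_smul]
    exact mul_left_cancel₀ hr.ne' this
  have hone : ∀ {W : Fin (n + 3) → ℝ}, 0 < weightNorm W →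
      ∑ l, dirVec (fun x => (weightNorm W)⁻¹ * W x) l ^ 2 +
        ((weightNorm W)⁻¹ * W (labelO n)) ^ 2 = 1 := by
    intro W hN
    simp only [dirVec_smul, mul_pow, ← Finset.mul_sum, ← mul_add]
    rw [← weightNorm_sq, ← mul_pow, inv_mul_cancel₀ hN.ne', one_pow]
  have hnonneg : ∀ (j : Idx n) (ρ : SignType) {W : Fin (n + 3) → ℝ},
      IsSignWeight (j.signs ρ) W → 0 ≤ W (labelO n) := by
    intro j ρ W hW
    rw [hW.sign, j.signs_labelO]
    cases j.prec <;> simp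
  obtain ⟨hJ, hV⟩ := eq_of_dirVec_eq hD (l := l) (by rw [hWl, mul_zero]) (by rw [hWl', mul_zero])
  have hO : a * W (labelO n) = a' * W' (labelO n) := by
    have h1 := hone hN
    have h2 := hone hN'
    rw [← ha, hD] at h1
    rw [← ha'] at h2
    exact (sq_eq_sq₀ (mul_nonneg ha0.le (hnonneg i τ hW))
      (mul_nonneg ha0'.le (hnonneg i' τ' hW'))).mp (by linarith)
  have hall : ∀ x, a * W x = a' * W' x := forall_labels.mpr ⟨hJ, hV, hO⟩
  have haa : a = a' := by
    have h1 : ∑ x, |a * W x| = a := by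
      simp only [abs_mul, abs_of_pos ha0, ← Finset.mul_sum, hW.sum_eq, mul_one]
    have h2 : ∑ x, |a' * W' x| = a' := by
      simp only [abs_mul, abs_of_pos ha0', ← Finset.mul_sum, hW'.sum_eq, mul_one]
    rw [← h1, ← h2]
    exact Finset.sum_congr rfl fun x _ => by rw [hall]
  funext x
  have := hall x
  rw [← haa] at this
  exact mul_left_cancel₀ ha0.ne' this

end Parametrization

/-! ### Products of simplices are balls -/

section Ball

/-- The barycentric coordinates on a simplex with vertices `0` and the standard basis vectors. -/
def cornerCoord {p : ℕ} (x : Fin p → ℝ) : Fin (p + 1) → ℝ :=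
  Fin.cons (α := fun _ => ℝ) (1 - ∑ j, x j) x

lemma sum_cornerCoord {p : ℕ} (x : Fin p → ℝ) : ∑ a, cornerCoord x a = 1 := by
  simp [cornerCoord, Fin.sum_univ_succ]

lemma continuous_cornerCoord {p : ℕ} (a : Fin (p + 1)) :
    Continuous fun x : Fin p → ℝ => cornerCoord x a := by
  refine Fin.cases ?_ (fun j => ?_) a
  · simp only [cornerCoord, Fin.cons_zero]
    fun_prop
  · simp only [cornerCoord, Fin.cons_succ]
    fun_prop

lemma cornerCoord_combo {p : ℕ} (x y : Fin p → ℝ) {s t : ℝ} (h : s + t = 1) (a : Fin (p + 1)) :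
    cornerCoord (fun j => s * x j + t * y j) a = s * cornerCoord x a + t * cornerCoord y a := by
  refine Fin.cases ?_ (fun j => ?_) a
  · simp only [cornerCoord, Fin.cons_zero, Finset.sum_add_distrib, ← Finset.mul_sum]
    linear_combination -h
  · simp only [cornerCoord, Fin.cons_succ]

lemma cornerCoord_tail {p : ℕ} {b : Fin (p + 1) → ℝ} (h : ∑ a, b a = 1) :
    cornerCoord (fun j => b j.succ) = b := by
  funext a
  refine Fin.cases ?_ (fun j => ?_) a
  · rw [Fin.sum_univ_succ] at h
    simp only [cornerCoord, Fin.cons_zero]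
    linarith
  · simp only [cornerCoord, Fin.cons_succ]

/-- The product of two simplices is homeomorphic to a closed ball, and the interior of the ball
corresponds to the points with positive barycentric coordinates. -/
theorem exists_homeomorph_closedBall {p q d : ℕ} (h : p + q = d) :
    ∃ e : stdSimplex ℝ (Fin (p + 1)) × stdSimplex ℝ (Fin (q + 1)) ≃ₜ
        Metric.closedBall (0 : Fin d → ℝ) 1,
      ∀ x, (e x : Fin d → ℝ) ∈ Metric.ball (0 : Fin d → ℝ) 1 ↔
        (∀ a, 0 < x.1 a) ∧ ∀ b, 0 < x.2 b := by
  subst h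
  set E := (finSumFinEquiv : Fin p ⊕ Fin q ≃ Fin (p + q)) with hE
  -- the product of simplices as a convex body
  let κ : (Fin (p + q) → ℝ) → Fin (p + 1) ⊕ Fin (q + 1) → ℝ := fun x =>
    Sum.elim (cornerCoord fun j => x (E (Sum.inl j))) (cornerCoord fun j => x (E (Sum.inr j)))
  let K : Set (Fin (p + q) → ℝ) := {x | ∀ a, 0 ≤ κ x a}
  let g : stdSimplex ℝ (Fin (p + 1)) × stdSimplex ℝ (Fin (q + 1)) → Fin (p + q) → ℝ :=
    fun x k => Sum.elim (fun j : Fin p => x.1 j.succ) (fun j : Fin q => x.2 j.succ) (E.symm k)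
  have hκ_cont : ∀ a, Continuous fun x => κ x a := by
    rintro (a | a)
    · exact (continuous_cornerCoord a).comp (by fun_prop)
    · exact (continuous_cornerCoord a).comp (by fun_prop)
  have hκ_combo : ∀ (x y : Fin (p + q) → ℝ) (s t : ℝ), s + t = 1 → ∀ a,
      κ (fun k => s * x k + t * y k) a = s * κ x a + t * κ y a := by
    rintro x y s t hst (a | a)
    · exact cornerCoord_combo _ _ hst a
    · exact cornerCoord_combo _ _ hst a
  have hκg : ∀ x, κ (g x) = Sum.elim x.1 x.2 := by
    intro x
    have h1 := cornerCoord_tail (stdSimplex.sum_eq_one x.1)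
    have h2 := cornerCoord_tail (stdSimplex.sum_eq_one x.2)
    funext a
    rcases a with a | a
    · simp only [κ, g, Sum.elim_inl, Equiv.symm_apply_apply]
      exact congrFun h1 a
    · simp only [κ, g, Sum.elim_inr, Equiv.symm_apply_apply]
      exact congrFun h2 a
  have hg_cont : Continuous g := by
    refine continuous_pi fun k => ?_
    rcases hk : E.symm k with j | j
    · simp only [g, hk, Sum.elim_inl]
      exact (continuous_apply j.succ).comp (continuous_subtype_val.comp continuous_fst)
    · simp only [g, hk, Sum.elim_inr]
      exact (continuous_apply j.succ).comp (continuous_subtype_val.comp continuous_snd)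
  have hg_inj : Function.Injective g := by
    intro x y hxy
    have h1 := hκg x
    rw [hxy, hκg y] at h1
    refine Prod.ext (stdSimplex.ext ?_) (stdSimplex.ext ?_)
    · funext a; exact (congrFun h1 (Sum.inl a)).symm
    · funext a; exact (congrFun h1 (Sum.inr a)).symm
  have hg_range : Set.range g = K := by
    ext x
    constructor
    · rintro ⟨y, rfl⟩ a
      rw [hκg]
      rcases a with a | a
      · exact stdSimplex.zero_le _ _
      · exact stdSimplex.zero_le _ _
    · intro hx
      refine ⟨(⟨_, fun a => hx (Sum.inl a), sum_cornerCoord _⟩,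
        ⟨_, fun a => hx (Sum.inr a), sum_cornerCoord _⟩), ?_⟩
      funext k
      obtain ⟨j, rfl⟩ := E.surjective k
      rcases j with j | j
      · simp only [g, Equiv.symm_apply_apply, Sum.elim_inl]
        exact Fin.cons_succ (α := fun _ => ℝ) (1 - ∑ j, x (E (Sum.inl j)))
          (fun j => x (E (Sum.inl j))) j
      · simp only [g, Equiv.symm_apply_apply, Sum.elim_inr]
        exact Fin.cons_succ (α := fun _ => ℝ) (1 - ∑ j, x (E (Sum.inr j)))
          (fun j => x (E (Sum.inr j))) j
  have hK_compact : IsCompact K := hg_range ▸ isCompact_range hg_cont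
  have hK_convex : Convex ℝ K := by
    intro x hx y hy s t hs ht hst a
    have := hκ_combo x y s t hst a
    rw [show s • x + t • y = fun k => s * x k + t * y k from rfl, this]
    exact add_nonneg (mul_nonneg hs (hx a)) (mul_nonneg ht (hy a))
  let x₀ := g (stdSimplex.barycenter, stdSimplex.barycenter)
  have hx₀ : ∀ a, 0 < κ x₀ a := by
    intro a
    rw [hκg]
    rcases a with a | a
    · change (0 : ℝ) < (Fintype.card (Fin (p + 1)) : ℝ)⁻¹
      rw [Fintype.card_fin]; positivity
    · change (0 : ℝ) < (Fintype.card (Fin (q + 1)) : ℝ)⁻¹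
      rw [Fintype.card_fin]; positivity
  have hK_int : ∀ x, x ∈ interior K ↔ ∀ a, 0 < κ x a := by
    intro x
    constructor
    · intro hx a
      -- moving away from the barycentre, the point would leave the body if a coordinate vanished
      by_contra ha
      have ha0 : κ x a = 0 := le_antisymm (not_lt.mp ha) (interior_subset hx a)
      have hc : Continuous fun t : ℝ => (fun k => (1 + t) * x k + (-t) * x₀ k) := by fun_prop
      have hmem : ∀ᶠ t : ℝ in nhds 0, (fun k => (1 + t) * x k + (-t) * x₀ k) ∈ interior K := by
        refine hc.continuousAt.eventually_mem (isOpen_interior.mem_nhds ?_)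
        simpa using hx
      obtain ⟨ε, hε, hball⟩ := Metric.eventually_nhds_iff.mp hmem
      have h1 := interior_subset (hball (y := ε / 2)
        (by rw [Real.dist_eq, sub_zero, abs_of_pos (by positivity)]; linarith)) a
      rw [hκ_combo _ _ _ _ (by ring), ha0] at h1
      nlinarith [hx₀ a]
    · intro hx
      refine mem_interior.mpr ⟨{x | ∀ a, 0 < κ x a}, fun y hy a => (hy a).le, ?_, hx⟩
      rw [Set.ofPred_forall]
      exact isOpen_iInter_of_finite fun a => isOpen_lt continuous_const (hκ_cont a)
  obtain ⟨H, H1, H2, -⟩ := exists_homeomorph_image_interior_closure_frontier_eq_unitBall hK_convex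
    ⟨x₀, (hK_int _).mpr hx₀⟩ hK_compact.isBounded
  rw [hK_compact.isClosed.closure_eq] at H2
  have hmem : ∀ x, H (g x) ∈ Metric.closedBall (0 : Fin (p + q) → ℝ) 1 := by
    intro x
    rw [← H2, ← hg_range]
    exact ⟨_, ⟨x, rfl⟩, rfl⟩
  have hbij : Function.Bijective fun x =>
      (⟨H (g x), hmem x⟩ : Metric.closedBall (0 : Fin (p + q) → ℝ) 1) := by
    constructor
    · intro x y hxy
      exact hg_inj (H.injective (congrArg Subtype.val hxy))
    · rintro ⟨y, hy⟩
      rw [← H2, ← hg_range] at hy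
      obtain ⟨_, ⟨x, rfl⟩, rfl⟩ := hy
      exact ⟨x, rfl⟩
  have hcont : Continuous (Equiv.ofBijective _ hbij) :=
    Continuous.subtype_mk (H.continuous.comp hg_cont) _
  refine ⟨hcont.homeoOfEquivCompactToT2, fun x => ?_⟩
  change H (g x) ∈ Metric.ball (0 : Fin (p + q) → ℝ) 1 ↔ _
  rw [← H1, H.injective.mem_set_image, hK_int, hκg, Sum.forall]
  rfl

/-- The inverse of an injective continuous function on a compact set is continuous. -/
lemma continuousOn_invFunOn {E X : Type} [TopologicalSpace E] [TopologicalSpace X] [T2Space X]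
    [Nonempty E] {K s : Set E} (hK : IsCompact K) (hs : s ⊆ K) {f : E → X} (hf : ContinuousOn f K)
    (hinj : Set.InjOn f K) : ContinuousOn (Function.invFunOn f s) (f '' s) := by
  have : CompactSpace K := isCompact_iff_compactSpace.mp hK
  have hemb : Topology.IsClosedEmbedding (K.domRestrict f) :=
    Continuous.isClosedEmbedding (continuousOn_iff_continuous_domRestrict.mp hf)
      (Set.injOn_iff_injective.mp hinj)
  have hmem : ∀ y : f '' s, Function.invFunOn f s y ∈ K := fun y =>
    hs (Function.invFunOn_mem y.2)
  have hcont : Continuous fun y : f '' s => (⟨Function.invFunOn f s y, hmem y⟩ : K) := by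
    rw [hemb.isEmbedding.isInducing.continuous_iff]
    convert! continuous_subtype_val (p := (· ∈ f '' s)) using 1
    funext y
    exact Function.invFunOn_eq y.2
  exact continuousOn_iff_continuous_domRestrict.mpr (continuous_subtype_val.comp hcont)

end Ball

/-! ### Simplices with vertices listed in order -/

section Labels

variable {α : Type}

section

variable [Inhabited α]

/-- The sequence of vertex labels given by a list. The values beyond the length of the list are
irrelevant; a total function makes faces correspond to composition with `skip`. -/
def listLabel (L : List α) (a : ℕ) : α := L.getD a default

lemma listLabel_mem {L : List α} {a : ℕ} (h : a < L.length) : listLabel L a ∈ L := by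
  rw [listLabel, List.getD_eq_getElem _ _ h]
  exact List.getElem_mem h

lemma listLabel_injective {L : List α} (hL : L.Nodup) {p : ℕ} (hp : L.length = p) :
    Function.Injective fun a : Fin p => listLabel L a := by
  intro a b hab
  simp only [listLabel] at hab
  rw [List.getD_eq_getElem _ _ (by omega), List.getD_eq_getElem _ _ (by omega)] at hab
  exact Fin.ext ((List.Nodup.getElem_inj_iff hL).mp hab)

lemma exists_listLabel_eq {L : List α} {p : ℕ} (hp : L.length = p) {x : α} (hx : x ∈ L) :
    ∃ a : Fin p, listLabel L a = x := by
  obtain ⟨a, ha, rfl⟩ := List.getElem_of_mem hx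
  exact ⟨⟨a, hp ▸ ha⟩, List.getD_eq_getElem _ _ ha⟩

lemma listLabel_eraseIdx (L : List α) (a k : ℕ) :
    listLabel (L.eraseIdx a) k = listLabel L (skip a k) := by
  rw [listLabel, listLabel, List.getD_eq_getElem?_getD, List.getD_eq_getElem?_getD,
    List.getElem?_eraseIdx, skip]
  split_ifs <;> rfl

end

variable [Fintype α]

lemma labelMap_apply {β : Type} [Fintype β] [DecidableEq α] (h : β → α) (s : stdSimplex ℝ β)
    (x : α) : labelMap h s x = ∑ b, if h b = x then s b else 0 := by
  change FunOnFinite.linearMap ℝ ℝ h s x = _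
  rw [FunOnFinite.linearMap_apply_apply, Finset.sum_filter]

lemma labelMap_apply_self {β : Type} [Fintype β] {h : β → α} (hh : Function.Injective h)
    (s : stdSimplex ℝ β) (b : β) : labelMap h s (h b) = s b := by
  classical
  rw [labelMap_apply, Finset.sum_eq_single b]
  · simp
  · intro c _ hc
    rw [if_neg (hh.ne hc)]
  · simp

lemma labelMap_injective {β : Type} [Fintype β] {h : β → α} (hh : Function.Injective h) :
    Function.Injective (labelMap h) := by
  intro s t hst
  refine stdSimplex.ext (funext fun b => ?_)
  rw [← labelMap_apply_self hh s, ← labelMap_apply_self hh t, hst]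

lemma labelMap_apply_of_notMem {β : Type} [Fintype β] {h : β → α} (s : stdSimplex ℝ β) {x : α}
    (hx : ∀ b, h b ≠ x) : labelMap h s x = 0 := by
  classical
  rw [labelMap_apply]
  exact Finset.sum_eq_zero fun b _ => if_neg (hx b)

lemma isListWeight_labelMap {L : List α} {β : Type} [Fintype β] {h : β → α} (hh : ∀ b, h b ∈ L)
    (s : stdSimplex ℝ β) : IsListWeight L (labelMap h s) := by
  refine ⟨fun x => stdSimplex.zero_le _ _, stdSimplex.sum_eq_one _, fun x hx => ?_⟩
  exact labelMap_apply_of_notMem s fun b hb => hx (hb ▸ hh b)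

variable [Inhabited α]

lemma exists_labelMap_eq {L : List α} (hL : L.Nodup) {p : ℕ} (hp : L.length = p)
    {w : α → ℝ} (hw : IsListWeight L w) :
    ∃ s : stdSimplex ℝ (Fin p), (labelMap (fun a : Fin p => listLabel L a) s : α → ℝ) = w := by
  classical
  have hinj := listLabel_injective hL hp
  have hsum : ∑ a : Fin p, w (listLabel L a) = 1 := by
    rw [← hw.sum_eq, ← Finset.sum_image (f := w) (g := fun a : Fin p => listLabel L a) hinj.injOn]
    refine Finset.sum_subset (Finset.subset_univ _) fun x _ hx => hw.support x fun hxL => hx ?_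
    obtain ⟨a, rfl⟩ := exists_listLabel_eq hp hxL
    exact Finset.mem_image_of_mem (fun a : Fin p => listLabel L a) (Finset.mem_univ a)
  refine ⟨⟨fun a => w (listLabel L a), fun a => hw.nonneg _, hsum⟩, funext fun x => ?_⟩
  by_cases hx : x ∈ L
  · obtain ⟨a, rfl⟩ := exists_listLabel_eq hp hx
    exact labelMap_apply_self hinj _ a
  · rw [hw.support x hx]
    exact labelMap_apply_of_notMem (h := fun a : Fin p => listLabel L a) _ fun a ha =>
      hx (ha ▸ listLabel_mem (hp ▸ a.2))

end Labels

/-! ### Characteristic maps -/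

section Characteristic

variable {n : ℕ}

/-- The labels of nonzero sign, in increasing order. -/
def signSupport (σ : Fin (n + 3) → SignType) : List (Fin (n + 3)) :=
  (Finset.univ.filter fun x => σ x ≠ 0).sort (· ≤ ·)

lemma mem_signSupport {σ : Fin (n + 3) → SignType} {x : Fin (n + 3)} :
    x ∈ signSupport σ ↔ σ x ≠ 0 := by
  simp [signSupport]

lemma nodup_signSupport (σ : Fin (n + 3) → SignType) : (signSupport σ).Nodup :=
  Finset.sort_nodup _ _

lemma IsListWeight.signWeight {σ : Fin (n + 3) → SignType} {w : Fin (n + 3) → ℝ}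
    (hw : IsListWeight (signSupport σ) w) :
    IsSignWeight σ (fun x => (σ x : ℝ) * w x) ∧ ∀ x, |(σ x : ℝ) * w x| = w x := by
  have h : ∀ x, |(σ x : ℝ) * w x| = w x := by
    intro x
    rw [abs_mul, abs_of_nonneg (hw.nonneg x)]
    by_cases hx : σ x = 0
    · rw [hw.support x (by rwa [mem_signSupport, not_not]), mul_zero]
    · cases hs : σ x <;> simp_all
  refine ⟨⟨fun x => by rw [h], ?_⟩, h⟩
  simp only [h, hw.sum_eq]

lemma IsSignWeight.listWeight {σ : Fin (n + 3) → SignType} {W : Fin (n + 3) → ℝ}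
    (hW : IsSignWeight σ W) : IsListWeight (signSupport σ) fun x => |W x| := by
  refine ⟨fun x => abs_nonneg _, hW.sum_eq, fun x hx => ?_⟩
  rw [mem_signSupport, not_not] at hx
  rw [hW.eq_zero hx, abs_zero]

/-- A variant of the norm that vanishes nowhere on the simplex of all weights. It agrees with
`weightNorm` when the weights vanish at the labels of sign `0`. -/
def simplexNorm (σ : Fin (n + 3) → SignType) (w : Fin (n + 3) → ℝ) : ℝ :=
  Real.sqrt (∑ l, dirVec (fun x => (σ x : ℝ) * w x) l ^ 2 + w (labelO n) ^ 2 +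
    ∑ x, if σ x = 0 then w x ^ 2 else 0)

lemma coe_sign_ne_zero {s : SignType} (h : s ≠ 0) : (s : ℝ) ≠ 0 := by
  cases s <;> simp_all

lemma simplexNorm_pos {σ : Fin (n + 3) → SignType} {l : Fin (n + 1)} (hσ : σ (labelJ l) = 0)
    (w : stdSimplex ℝ (Fin (n + 3))) : 0 < simplexNorm σ w := by
  have h1 : 0 ≤ ∑ l, dirVec (fun x => (σ x : ℝ) * w x) l ^ 2 := by positivity
  have h2 : 0 ≤ w (labelO n) ^ 2 := sq_nonneg _
  have h3 : 0 ≤ ∑ x, if σ x = 0 then w x ^ 2 else 0 :=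
    Finset.sum_nonneg fun x _ => by split_ifs <;> positivity
  refine Real.sqrt_pos.mpr (lt_of_le_of_ne (by positivity) fun h => ?_)
  have h4 : ∀ x, σ x = 0 → w x = 0 := by
    intro x hx
    have := (Finset.sum_eq_zero_iff_of_nonneg (fun x _ => by split_ifs <;> positivity)).mp
      (show ∑ x, (if σ x = 0 then w x ^ 2 else 0) = 0 by linarith) x (Finset.mem_univ _)
    rw [if_pos hx] at this
    exact pow_eq_zero_iff two_ne_zero |>.mp this
  obtain ⟨h5, h6⟩ := eq_zero_of_dirVec_eq_zero (W := fun x => (σ x : ℝ) * w x) (by linarith)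
    (l := l) (by rw [hσ]; simp)
  have h7 : ∀ x, (σ x : ℝ) * w x = 0 → w x = 0 := by
    intro x hx
    by_cases h0 : σ x = 0
    · exact h4 x h0
    · exact (mul_eq_zero.mp hx).resolve_left (coe_sign_ne_zero h0)
  have h8 : ∀ x, w x = 0 := forall_labels.mpr ⟨fun j => h7 _ (h5 j), h7 _ h6,
    pow_eq_zero_iff two_ne_zero |>.mp (by linarith)⟩
  have := stdSimplex.sum_eq_one w
  simp [h8] at this

lemma simplexNorm_eq {σ : Fin (n + 3) → SignType} {w : Fin (n + 3) → ℝ}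
    (hw : IsListWeight (signSupport σ) w) :
    simplexNorm σ w = weightNorm fun x => (σ x : ℝ) * w x := by
  have h1 : ∀ x, (if σ x = 0 then w x ^ 2 else 0) = 0 := by
    intro x
    split_ifs with hx
    · rw [hw.support x (by rwa [mem_signSupport, not_not])]; norm_num
    · rfl
  have h2 : ((σ (labelO n) : ℝ) * w (labelO n)) ^ 2 = w (labelO n) ^ 2 := by
    rw [← sq_abs, hw.signWeight.2]
  rw [simplexNorm, weightNorm, h2, Finset.sum_congr rfl fun x _ => h1 x, Finset.sum_const_zero,
    add_zero]

/-- The map from the simplex of weights on the vertices in the real directions times the simplex of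
weights on the barycentres. -/
def cellMap (σ : Fin (n + 3) → SignType) (hσ : ∃ l, σ (labelJ l) = 0) :
    C(stdSimplex ℝ (Fin (n + 3)) × stdSimplex ℝ (Finset (Fin (n + 1))), Fin (n + 1) → ℂ) where
  toFun s l := ⟨radius (barySum s.2) / simplexNorm σ s.1 * dirVec (fun x => (σ x : ℝ) * s.1 x) l,
    barySum s.2 l⟩
  continuous_toFun := by
    obtain ⟨l₀, hl₀⟩ := hσ
    have hw : ∀ x, Continuous fun s : stdSimplex ℝ (Fin (n + 3)) ×
        stdSimplex ℝ (Finset (Fin (n + 1))) => s.1 x := fun x =>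
      (continuous_apply x).comp (continuous_subtype_val.comp continuous_fst)
    have hu : ∀ S, Continuous fun s : stdSimplex ℝ (Fin (n + 3)) ×
        stdSimplex ℝ (Finset (Fin (n + 1))) => s.2 S := fun S =>
      (continuous_apply S).comp (continuous_subtype_val.comp continuous_snd)
    have hσw : ∀ x, Continuous fun s : stdSimplex ℝ (Fin (n + 3)) ×
        stdSimplex ℝ (Finset (Fin (n + 1))) => (σ x : ℝ) * s.1 x := fun x =>
      continuous_const.mul (hw x)
    have hD : ∀ l, Continuous fun s : stdSimplex ℝ (Fin (n + 3)) ×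
        stdSimplex ℝ (Finset (Fin (n + 1))) => dirVec (fun x => (σ x : ℝ) * s.1 x) l := fun l =>
      ((hσw _).add (continuous_finsetSum _ fun j _ => hσw _)).sub (hσw _)
    have hy : ∀ l, Continuous fun s : stdSimplex ℝ (Fin (n + 3)) ×
        stdSimplex ℝ (Finset (Fin (n + 1))) => barySum s.2 l := fun l =>
      continuous_finsetSum _ fun S _ => (hu S).mul continuous_const
    have hr : Continuous fun s : stdSimplex ℝ (Fin (n + 3)) ×
        stdSimplex ℝ (Finset (Fin (n + 1))) => radius (barySum s.2) := by
      refine Real.continuous_sqrt.comp ((continuous_const.add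
        (continuous_finsetSum _ fun l _ => (hy l).pow 2)).sub (continuous_const.mul ?_))
      exact Continuous.finset_sup'_apply _ fun l _ => hy l
    have hN : Continuous fun s : stdSimplex ℝ (Fin (n + 3)) ×
        stdSimplex ℝ (Finset (Fin (n + 1))) => simplexNorm σ s.1 := by
      refine Real.continuous_sqrt.comp (((continuous_finsetSum _ fun l _ => (hD l).pow 2).add
        ((hw _).pow 2)).add (continuous_finsetSum _ fun x _ => ?_))
      split_ifs
      · exact (hw x).pow 2
      · exact continuous_const
    refine continuous_pi fun l => ?_
    simp only [Complex.mk_eq_add_mul_I]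
    exact (Complex.continuous_ofReal.comp
      ((hr.div hN fun s => (simplexNorm_pos hl₀ s.1).ne').mul (hD l))).add
      ((Complex.continuous_ofReal.comp (hy l)).mul continuous_const)

lemma cellMap_apply {σ : Fin (n + 3) → SignType} (hσ : ∃ l, σ (labelJ l) = 0)
    {s : stdSimplex ℝ (Fin (n + 3)) × stdSimplex ℝ (Finset (Fin (n + 1)))}
    (hs : IsListWeight (signSupport σ) s.1) :
    cellMap σ hσ s = weightPoint (fun x => (σ x : ℝ) * s.1 x) s.2 := by
  funext l
  rw [weightPoint, ← simplexNorm_eq hs]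
  rfl

/-- The map `cellMap` only depends on the signs at the labels of nonzero weight. -/
lemma cellMap_congr {σ σ' : Fin (n + 3) → SignType} (hσ : ∃ l, σ (labelJ l) = 0)
    (hσ' : ∃ l, σ' (labelJ l) = 0)
    {s : stdSimplex ℝ (Fin (n + 3)) × stdSimplex ℝ (Finset (Fin (n + 1)))}
    (hs : IsListWeight (signSupport σ') s.1) (h : ∀ x, σ' x ≠ 0 → σ x = σ' x) :
    cellMap σ hσ s = cellMap σ' hσ' s := by
  have hs' : IsListWeight (signSupport σ) s.1 := by
    refine ⟨hs.nonneg, hs.sum_eq, fun x hx => hs.support x fun hx' => hx ?_⟩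
    rw [mem_signSupport] at hx' ⊢
    rwa [h x hx']
  rw [cellMap_apply hσ hs', cellMap_apply hσ' hs]
  congr 1
  funext x
  by_cases hx : σ' x = 0
  · rw [hs.support x (by rwa [mem_signSupport, not_not]), mul_zero, mul_zero]
  · rw [h x hx]

namespace Idx

variable (i : Idx n) (τ : SignType)

lemma exists_signs_eq_zero : ∃ l, i.signs τ (labelJ l) = 0 := ⟨_, i.signs_minHead τ⟩

/-- The characteristic map of `e_i^τ`, on a product of simplices of arbitrary dimensions; it is
used for `p = dimFst` and `q = dimSnd`. -/
def param (p q : ℕ) :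
    C(stdSimplex ℝ (Fin (p + 1)) × stdSimplex ℝ (Fin (q + 1)), Fin (n + 1) → ℂ) :=
  (cellMap (i.signs τ) (i.exists_signs_eq_zero τ)).comp
    (labelProd p q (listLabel (signSupport (i.signs τ))) (listLabel i.chain))

lemma length_signSupport :
    (signSupport (i.signs τ)).length = i.J.card + absSign τ + i.prec.delta := by
  classical
  rw [signSupport, Finset.length_sort, Finset.card_filter, sum_labels]
  congr 1
  · congr 1
    · simp only [i.signs_labelJ_ne_zero τ]
      rw [← Finset.card_filter]
      congr 1
      ext j
      simp
    · rw [i.signs_labelV]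
      cases τ <;> simp [absSign]
  · simp only [i.signs_labelO_ne_zero τ]
    cases i.prec <;> simp [Prec.delta]

lemma length_chain : i.chain.length = i.dimSnd + 1 := by
  have := List.length_pos_iff.mpr i.chain_ne_nil
  rw [dimSnd]
  omega

lemma nodup_chain : i.chain.Nodup :=
  i.strict.imp fun h => h.ne

lemma isListWeight_single_head :
    IsListWeight i.chain (Pi.single (i.chain.head i.chain_ne_nil) 1) := by
  refine ⟨fun S => ?_, by simp, fun S hS => ?_⟩
  · rw [Pi.single_apply]; split_ifs <;> norm_num
  · rw [Pi.single_apply, if_neg]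
    rintro rfl
    exact hS (List.head_mem _)

lemma cellSet_nonempty_iff : (i.cellSet τ).Nonempty ↔ 0 < (signSupport (i.signs τ)).length := by
  rw [List.length_pos_iff_exists_mem]
  constructor
  · rintro ⟨z, hz⟩
    obtain ⟨W, u, hW, -, -⟩ := (i.mem_cellSet τ z).mp hz
    by_contra! h
    refine hW.ne_zero (funext fun x => hW.eq_zero ?_)
    have := h x
    rwa [mem_signSupport, not_not] at this
  · rintro ⟨x, hx⟩
    have hw : IsListWeight (signSupport (i.signs τ)) (Pi.single x 1) := by
      refine ⟨fun y => ?_, by simp, fun y hy => ?_⟩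
      · rw [Pi.single_apply]; split_ifs <;> norm_num
      · rw [Pi.single_apply, if_neg]
        rintro rfl
        exact hy hx
    exact ⟨_, (i.mem_cellSet τ _).mpr ⟨_, _, hw.signWeight.1, i.isListWeight_single_head, rfl⟩⟩

variable {i τ}

lemma length_signSupport_eq (h : (i.cellSet τ).Nonempty) :
    (signSupport (i.signs τ)).length = i.dimFst τ + 1 := by
  have := (i.cellSet_nonempty_iff τ).mp h
  rw [length_signSupport] at this ⊢
  rw [dimFst]
  omega

lemma isListWeight_fst {p : ℕ} (hp : p + 1 ≤ (signSupport (i.signs τ)).length)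
    (b : stdSimplex ℝ (Fin (p + 1))) :
    IsListWeight (signSupport (i.signs τ))
      (labelMap (fun a : Fin (p + 1) => listLabel (signSupport (i.signs τ)) a) b) :=
  isListWeight_labelMap (fun a => listLabel_mem (by omega)) b

lemma isListWeight_snd (c : stdSimplex ℝ (Fin (i.dimSnd + 1))) :
    IsListWeight i.chain (labelMap (fun a : Fin (i.dimSnd + 1) => listLabel i.chain a) c) :=
  isListWeight_labelMap (fun a => listLabel_mem (by rw [i.length_chain]; exact a.2)) c

lemma param_apply (h : (i.cellSet τ).Nonempty)
    (s : stdSimplex ℝ (Fin (i.dimFst τ + 1)) × stdSimplex ℝ (Fin (i.dimSnd + 1))) :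
    i.param τ (i.dimFst τ) i.dimSnd s = weightPoint
      (fun x => (i.signs τ x : ℝ) *
        labelMap (fun a : Fin (i.dimFst τ + 1) => listLabel (signSupport (i.signs τ)) a) s.1 x)
      (labelMap (fun a : Fin (i.dimSnd + 1) => listLabel i.chain a) s.2) :=
  cellMap_apply (i.exists_signs_eq_zero τ) (isListWeight_fst (length_signSupport_eq h).ge s.1)

lemma param_mem (h : (i.cellSet τ).Nonempty)
    (s : stdSimplex ℝ (Fin (i.dimFst τ + 1)) × stdSimplex ℝ (Fin (i.dimSnd + 1))) :
    i.param τ (i.dimFst τ) i.dimSnd s ∈ i.cellSet τ := by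
  rw [param_apply h]
  exact (i.mem_cellSet τ _).mpr ⟨_, _,
    (isListWeight_fst (length_signSupport_eq h).ge s.1).signWeight.1, isListWeight_snd s.2, rfl⟩

lemma param_injective (h : (i.cellSet τ).Nonempty) :
    Function.Injective (i.param τ (i.dimFst τ) i.dimSnd) := by
  intro s t hst
  rw [param_apply h, param_apply h] at hst
  have hs := (isListWeight_fst (length_signSupport_eq h).ge s.1).signWeight
  have ht := (isListWeight_fst (length_signSupport_eq h).ge t.1).signWeight
  obtain ⟨h1, h2⟩ := weights_unique i i τ τ hs.1 ht.1 (isListWeight_snd s.2)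
    (isListWeight_snd t.2) hst
  refine Prod.ext (labelMap_injective (listLabel_injective (nodup_signSupport _)
    (length_signSupport_eq h)) ?_) (labelMap_injective (listLabel_injective i.nodup_chain
    i.length_chain) ?_)
  · refine stdSimplex.ext (funext fun x => ?_)
    rw [← hs.2 x, ← ht.2 x]
    exact congrArg abs (congrFun h1 x)
  · exact stdSimplex.ext h2

lemma exists_param_eq (h : (i.cellSet τ).Nonempty) {z : Fin (n + 1) → ℂ} (hz : z ∈ i.cellSet τ) :
    ∃ s, i.param τ (i.dimFst τ) i.dimSnd s = z := by
  obtain ⟨W, u, hW, hu, rfl⟩ := (i.mem_cellSet τ z).mp hz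
  obtain ⟨b, hb⟩ := exists_labelMap_eq (nodup_signSupport _) (length_signSupport_eq h)
    hW.listWeight
  obtain ⟨c, hc⟩ := exists_labelMap_eq i.nodup_chain i.length_chain hu
  refine ⟨(b, c), ?_⟩
  rw [param_apply h, hb, hc]
  congr 1
  funext x
  exact (hW.sign x).symm

/-- The homeomorphism of a product of two simplices with a nonempty cell. -/
def paramHomeo (i : Idx n) (τ : SignType) (h : (i.cellSet τ).Nonempty) :
    stdSimplex ℝ (Fin (i.dimFst τ + 1)) × stdSimplex ℝ (Fin (i.dimSnd + 1)) ≃ₜ i.cellSet τ :=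
  Continuous.homeoOfEquivCompactToT2
    (f := Equiv.ofBijective (fun s => ⟨i.param τ (i.dimFst τ) i.dimSnd s, param_mem h s⟩)
      ⟨fun _ _ hst => param_injective h (congrArg Subtype.val hst), fun z => by
        obtain ⟨s, hs⟩ := exists_param_eq h z.2
        exact ⟨s, Subtype.ext hs⟩⟩)
    (Continuous.subtype_mk (i.param τ (i.dimFst τ) i.dimSnd).continuous _)

/-- The open cells are disjoint: a point with positive barycentric coordinates determines the signs
and the chain, hence the cell. -/
lemma eq_of_param_eq {i' : Idx n} {τ' : SignType} (h : (i.cellSet τ).Nonempty)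
    (h' : (i'.cellSet τ').Nonempty)
    {s : stdSimplex ℝ (Fin (i.dimFst τ + 1)) × stdSimplex ℝ (Fin (i.dimSnd + 1))}
    {s' : stdSimplex ℝ (Fin (i'.dimFst τ' + 1)) × stdSimplex ℝ (Fin (i'.dimSnd + 1))}
    (hs : (∀ a, 0 < s.1 a) ∧ ∀ b, 0 < s.2 b) (hs' : (∀ a, 0 < s'.1 a) ∧ ∀ b, 0 < s'.2 b)
    (hss : i.param τ (i.dimFst τ) i.dimSnd s = i'.param τ' (i'.dimFst τ') i'.dimSnd s') :
    i = i' ∧ τ = τ' := by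
  classical
  -- for positive coordinates, the weights determine the signs and the members of the chain
  have key1 : ∀ (i : Idx n) (τ : SignType) (h : (i.cellSet τ).Nonempty)
      (b : stdSimplex ℝ (Fin (i.dimFst τ + 1))), (∀ a, 0 < b a) → ∀ x,
      SignType.sign ((i.signs τ x : ℝ) * labelMap (fun a : Fin (i.dimFst τ + 1) =>
        listLabel (signSupport (i.signs τ)) a) b x) = i.signs τ x := by
    intro i τ h b hb x
    by_cases hx : i.signs τ x = 0
    · rw [hx]; simp
    · obtain ⟨a, rfl⟩ := exists_listLabel_eq (length_signSupport_eq h) (mem_signSupport.mpr hx)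
      rw [labelMap_apply_self (h := fun a : Fin (i.dimFst τ + 1) =>
        listLabel (signSupport (i.signs τ)) a) (listLabel_injective (nodup_signSupport _)
        (length_signSupport_eq h)), sign_mul, sign_pos (hb a), mul_one]
      cases i.signs τ (listLabel (signSupport (i.signs τ)) a) <;> simp
  have key2 : ∀ (i : Idx n) (c : stdSimplex ℝ (Fin (i.dimSnd + 1))), (∀ a, 0 < c a) → ∀ S,
      S ∈ i.chain ↔ labelMap (fun a : Fin (i.dimSnd + 1) => listLabel i.chain a) c S ≠ 0 := by
    intro i c hc S
    constructor
    · intro hS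
      obtain ⟨a, rfl⟩ := exists_listLabel_eq i.length_chain hS
      rw [labelMap_apply_self (h := fun a : Fin (i.dimSnd + 1) => listLabel i.chain a)
        (listLabel_injective i.nodup_chain i.length_chain)]
      exact (hc a).ne'
    · intro hS
      by_contra hSi
      exact hS ((isListWeight_snd c).support S hSi)
  rw [param_apply h, param_apply h'] at hss
  obtain ⟨h1, h2⟩ := weights_unique i i' τ τ'
    (isListWeight_fst (length_signSupport_eq h).ge s.1).signWeight.1
    (isListWeight_fst (length_signSupport_eq h').ge s'.1).signWeight.1
    (isListWeight_snd s.2) (isListWeight_snd s'.2) hss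
  have hsign : ∀ x, i.signs τ x = i'.signs τ' x := by
    intro x
    rw [← key1 i τ h s.1 hs.1 x, ← key1 i' τ' h' s'.1 hs'.1 x]
    exact congrArg SignType.sign (congrFun h1 x)
  have hchain : i.chain = i'.chain := by
    refine List.Perm.eq_of_pairwise (le := (· ⊂ ·)) (fun S T _ _ hST hTS => ?_) i.strict i'.strict
      ((List.perm_ext_iff_of_nodup i.nodup_chain i'.nodup_chain).mpr fun S => ?_)
    · exact absurd hTS hST.asymm
    · rw [key2 i s.2 hs.2, key2 i' s'.2 hs'.2, h2]
  have hτ : τ = τ' := by rw [← i.signs_labelV τ, ← i'.signs_labelV τ', hsign]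
  refine ⟨?_, hτ⟩
  have hJ : ∀ j, (if j ∈ i.Jge then (1 : SignType) else if j ∈ i.Jle then -1 else 0) =
      if j ∈ i'.Jge then 1 else if j ∈ i'.Jle then -1 else 0 := by
    intro j
    rw [← i.signs_labelJ τ, ← i'.signs_labelJ τ', hsign]
  have hge : i.Jge = i'.Jge := by
    ext j
    have := hJ j
    split_ifs at this <;> simp_all
  have hle : i.Jle = i'.Jle := by
    ext j
    have h3 := hJ j
    have h4 : j ∈ i.Jle → j ∉ i.Jge := fun h => Finset.disjoint_left.mp i.J_disjoint h
    have h5 : j ∈ i'.Jle → j ∉ i'.Jge := fun h => Finset.disjoint_left.mp i'.J_disjoint h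
    split_ifs at h3 <;> simp_all
  have hprec : i.prec = i'.prec := by
    have h3 := i.signs_labelO_ne_zero τ
    rw [hsign, i'.signs_labelO_ne_zero τ'] at h3
    cases hp : i.prec <;> cases hp' : i'.prec <;> simp_all
  cases i
  cases i'
  simp_all

end Idx

end Characteristic

/-! ### Faces of cells -/

section Faces

variable {n : ℕ}

lemma signSupport_update {σ : Fin (n + 3) → SignType} {a : ℕ} (ha : a < (signSupport σ).length) :
    signSupport (Function.update σ (listLabel (signSupport σ) a) 0) =
      (signSupport σ).eraseIdx a := by
  have hsorted : (signSupport σ).Pairwise (· ≤ ·) := Finset.pairwise_sort _ _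
  refine List.Perm.eq_of_pairwise' (r := (· ≤ ·)) (Finset.pairwise_sort _ _)
    (hsorted.sublist (List.eraseIdx_sublist _ _))
    ((List.perm_ext_iff_of_nodup (nodup_signSupport _) ((nodup_signSupport σ).eraseIdx a)).mpr
      fun x => ?_)
  rw [listLabel, List.getD_eq_getElem _ _ ha, ← (nodup_signSupport σ).erase_getElem a ha,
    (nodup_signSupport σ).mem_erase_iff, mem_signSupport, mem_signSupport]
  by_cases hx : x = (signSupport σ)[a]
  · simp [hx]
  · simp [hx]

namespace Idx

variable (i : Idx n) (τ : SignType)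

lemma signs_eraseJ (j : Fin (n + 1)) :
    (i.eraseJ j).signs τ = Function.update (i.signs τ) (labelJ j) 0 := by
  funext x
  revert x
  refine forall_labels.mpr ⟨fun k => ?_, ?_, ?_⟩
  · by_cases hk : k = j
    · subst hk
      rw [Function.update_self, signs_labelJ]
      simp [eraseJ]
    · rw [Function.update_of_ne (by simpa [labelJ] using hk), signs_labelJ, signs_labelJ]
      simp [eraseJ, hk]
  · rw [Function.update_of_ne (by simp [labelV, labelJ, Fin.ext_iff]; omega), signs_labelV,
      signs_labelV]
  · rw [Function.update_of_ne (by simp [labelO, labelJ, Fin.ext_iff]; omega), signs_labelO,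
      signs_labelO]
    rfl

lemma signs_zero : i.signs 0 = Function.update (i.signs τ) (labelV n) 0 := by
  funext x
  revert x
  refine forall_labels.mpr ⟨fun k => ?_, ?_, ?_⟩
  · rw [Function.update_of_ne (by simp [labelV, labelJ, Fin.ext_iff]; omega), signs_labelJ,
      signs_labelJ]
  · rw [Function.update_self, signs_labelV]
  · rw [Function.update_of_ne (by simp [labelO, labelV, Fin.ext_iff]), signs_labelO,
      signs_labelO]

lemma signs_toEq : i.toEq.signs τ = Function.update (i.signs τ) (labelO n) 0 := by
  funext x
  revert x
  refine forall_labels.mpr ⟨fun k => ?_, ?_, ?_⟩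
  · rw [Function.update_of_ne (by simp [labelO, labelJ, Fin.ext_iff]; omega), signs_labelJ,
      signs_labelJ]
    rfl
  · rw [Function.update_of_ne (by simp [labelO, labelV, Fin.ext_iff]), signs_labelV,
      signs_labelV]
  · rw [Function.update_self, signs_labelO]
    rfl

lemma signs_eraseI (j : Fin i.chain.length) (h : 1 < i.chain.length) :
    (i.eraseI j h).signs τ = i.signs τ := rfl

lemma chain_eraseI (j : Fin i.chain.length) (h : 1 < i.chain.length) :
    (i.eraseI j h).chain = i.chain.eraseIdx j := rfl

/-- The pair `(i', τ')` is the face of `(i, τ)` opposite to the vertex `x` of the first factor. -/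
structure IsFaceFst (i' : Idx n) (τ' : SignType) (i : Idx n) (τ : SignType) (x : Fin (n + 3)) :
    Prop where
  signs_eq : i'.signs τ' = Function.update (i.signs τ) x 0
  chain_eq : i'.chain = i.chain

/-- The face of `(i, τ)` opposite to the vertex `x` of the first factor. -/
def faceFst (x : Fin (n + 3)) : Idx n × SignType :=
  Fin.snoc (α := fun _ => Idx n × SignType) (Fin.snoc (α := fun _ => Idx n × SignType)
    (fun j => (i.eraseJ j, τ)) (i, 0)) (i.toEq, τ) x

lemma faceFst_labelJ (j : Fin (n + 1)) : i.faceFst τ (labelJ j) = (i.eraseJ j, τ) := by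
  simp [faceFst, labelJ]

lemma faceFst_labelV : i.faceFst τ (labelV n) = (i, 0) := by
  simp [faceFst, labelV]

lemma faceFst_labelO : i.faceFst τ (labelO n) = (i.toEq, τ) := by
  simp [faceFst, labelO]

lemma isFaceFst_faceFst (x : Fin (n + 3)) :
    IsFaceFst (i.faceFst τ x).1 (i.faceFst τ x).2 i τ x := by
  revert x
  refine forall_labels.mpr ⟨fun j => ?_, ?_, ?_⟩
  · rw [faceFst_labelJ]
    exact ⟨i.signs_eraseJ τ j, rfl⟩
  · rw [faceFst_labelV]
    exact ⟨i.signs_zero τ, rfl⟩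
  · rw [faceFst_labelO]
    exact ⟨i.signs_toEq τ, rfl⟩

variable {i τ} {i' : Idx n} {τ' : SignType}

lemma IsFaceFst.signSupport_eq {a : ℕ} (ha : a < (signSupport (i.signs τ)).length)
    (hf : IsFaceFst i' τ' i τ (listLabel (signSupport (i.signs τ)) a)) :
    signSupport (i'.signs τ') = (signSupport (i.signs τ)).eraseIdx a := by
  rw [hf.signs_eq, signSupport_update ha]

lemma IsFaceFst.length_eq {x : Fin (n + 3)} (hx : i.signs τ x ≠ 0)
    (hf : IsFaceFst i' τ' i τ x) :
    (signSupport (i'.signs τ')).length + 1 = (signSupport (i.signs τ)).length := by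
  obtain ⟨a, rfl⟩ := exists_listLabel_eq rfl (mem_signSupport.mpr hx)
  have ha : (a : ℕ) < (signSupport (i.signs τ)).length := a.2
  rw [hf.signSupport_eq ha, List.length_eraseIdx_of_lt ha]
  omega

lemma IsFaceFst.dim_eq {x : Fin (n + 3)} (hx : i.signs τ x ≠ 0) (hf : IsFaceFst i' τ' i τ x)
    (h' : (i'.cellSet τ').Nonempty) :
    (i.cellSet τ).Nonempty ∧ i.dimFst τ = i'.dimFst τ' + 1 ∧ i'.dimSnd = i.dimSnd := by
  have hlen := hf.length_eq hx
  have h : (i.cellSet τ).Nonempty := (i.cellSet_nonempty_iff τ).mpr (by omega)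
  rw [length_signSupport_eq h, length_signSupport_eq h'] at hlen
  exact ⟨h, by omega, by rw [dimSnd, dimSnd, hf.chain_eq]⟩

lemma nonempty_eraseI_iff (j : Fin i.chain.length) (h : 1 < i.chain.length) :
    ((i.eraseI j h).cellSet τ).Nonempty ↔ (i.cellSet τ).Nonempty := by
  rw [cellSet_nonempty_iff, cellSet_nonempty_iff, signs_eraseI]

lemma dimFst_eraseI (j : Fin i.chain.length) (h : 1 < i.chain.length) :
    (i.eraseI j h).dimFst τ = i.dimFst τ := rfl

lemma dimSnd_eraseI (j : Fin i.chain.length) (h : 1 < i.chain.length) :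
    (i.eraseI j h).dimSnd + 1 = i.dimSnd := by
  rw [dimSnd, dimSnd, chain_eraseI, List.length_eraseIdx_of_lt j.2]
  omega

/-- The points with a vanishing barycentric coordinate lie in a cell of smaller dimension. -/
lemma exists_face_of_not_pos (h : (i.cellSet τ).Nonempty)
    {s : stdSimplex ℝ (Fin (i.dimFst τ + 1)) × stdSimplex ℝ (Fin (i.dimSnd + 1))}
    (hs : ¬ ((∀ a, 0 < s.1 a) ∧ ∀ b, 0 < s.2 b)) :
    ∃ (i' : Idx n) (τ' : SignType), i.param τ (i.dimFst τ) i.dimSnd s ∈ i'.cellSet τ' ∧ i'.dim τ' < i.dim τ := by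
  rw [param_apply h]
  have hw := isListWeight_fst (length_signSupport_eq h).ge s.1
  have hu := isListWeight_snd s.2
  rw [not_and_or] at hs
  push Not at hs
  rcases hs with ⟨a, ha⟩ | ⟨b, hb⟩
  · have ha0 : s.1 a = 0 := le_antisymm ha (stdSimplex.zero_le _ _)
    have halt : (a : ℕ) < (signSupport (i.signs τ)).length := by
      rw [length_signSupport_eq h]; exact a.2
    set x := listLabel (signSupport (i.signs τ)) a with hx
    have hx0 : i.signs τ x ≠ 0 := mem_signSupport.mp (listLabel_mem halt)
    have hwx := labelMap_apply_self (h := fun a : Fin (i.dimFst τ + 1) =>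
      listLabel (signSupport (i.signs τ)) a) (listLabel_injective (nodup_signSupport _)
      (length_signSupport_eq h)) s.1 a
    rw [ha0, ← hx] at hwx
    obtain ⟨i', τ', hf⟩ : ∃ i' τ', IsFaceFst i' τ' i τ x := ⟨_, _, i.isFaceFst_faceFst τ x⟩
    set w := labelMap (fun a : Fin (i.dimFst τ + 1) => listLabel (signSupport (i.signs τ)) a) s.1
    have hW : IsSignWeight (i'.signs τ') fun y => (i.signs τ y : ℝ) * w y := by
      refine ⟨fun y => ?_, hw.signWeight.1.sum_eq⟩
      rw [hf.signs_eq]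
      by_cases hy : y = x
      · rw [hy, hwx]; simp
      · rw [Function.update_of_ne hy]
        exact hw.signWeight.1.sign y
    have hmem : weightPoint (fun y => (i.signs τ y : ℝ) * w y)
        (labelMap (fun a : Fin (i.dimSnd + 1) => listLabel i.chain a) s.2) ∈ i'.cellSet τ' := by
      refine (i'.mem_cellSet τ' _).mpr ⟨_, _, hW, ?_, rfl⟩
      rw [hf.chain_eq]
      exact hu
    obtain ⟨-, h1, h2⟩ := hf.dim_eq hx0 ⟨_, hmem⟩
    exact ⟨i', τ', hmem, by rw [dim, dim]; omega⟩
  · have hb0 : s.2 b = 0 := le_antisymm hb (stdSimplex.zero_le _ _)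
    have hlen : 1 < i.chain.length := by
      -- a `0`-simplex has no point with a vanishing coordinate
      rw [i.length_chain]
      by_contra hq
      have h1 := stdSimplex.sum_eq_one s.2
      rw [Finset.sum_eq_single b] at h1
      · rw [hb0] at h1; norm_num at h1
      · intro c _ hc
        exact absurd (Fin.ext (by omega)) hc
      · simp
    have hblt : (b : ℕ) < i.chain.length := by rw [i.length_chain]; exact b.2
    have hub := labelMap_apply_self (h := fun a : Fin (i.dimSnd + 1) => listLabel i.chain a)
      (listLabel_injective i.nodup_chain i.length_chain) s.2 b
    refine ⟨i.eraseI ⟨b, hblt⟩ hlen, τ, ?_, ?_⟩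
    · refine (mem_cellSet _ τ _).mpr ⟨_, _, hw.signWeight.1, ⟨hu.nonneg, hu.sum_eq, ?_⟩, rfl⟩
      intro S hS
      by_cases hSi : S ∈ i.chain
      · rw [chain_eraseI, ← i.nodup_chain.erase_getElem b hblt, i.nodup_chain.mem_erase_iff] at hS
        have hSb : S = listLabel i.chain b := by
          rw [listLabel, List.getD_eq_getElem _ _ hblt]
          by_contra hne
          exact hS ⟨hne, hSi⟩
        rw [hSb, hub, hb0]
      · exact hu.support S hSi
    · have h1 := dimSnd_eraseI (i := i) ⟨b, hblt⟩ hlen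
      have h2 := dimFst_eraseI (i := i) (τ := τ) ⟨b, hblt⟩ hlen
      rw [dim, dim]
      omega

end Idx

end Faces

/-! ### The CW structure -/

section CW

variable {n : ℕ}

open Metric Set

namespace Idx

instance : Finite (Idx n) := by
  let f : Idx n → {L : List (Finset (Fin (n + 1))) // L.Nodup} × Finset (Fin (n + 1)) ×
      Finset (Fin (n + 1)) × Bool := fun i =>
    (⟨i.chain, i.nodup_chain⟩, i.Jle, i.Jge, match i.prec with | .le => true | .eq => false)
  refine Finite.of_injective f fun i i' h => ?_
  simp only [f, Prod.mk.injEq, Subtype.mk.injEq] at h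
  obtain ⟨h1, h2, h3, h4⟩ := h
  have h5 : i.prec = i'.prec := by
    cases hp : i.prec <;> cases hp' : i'.prec <;> simp_all
  cases i
  cases i'
  simp_all

lemma length_chain_le (i : Idx n) :
    i.chain.length ≤ (i.chain.getLast i.chain_ne_nil).card := by
  have hnodup : (i.chain.map Finset.card).Nodup := by
    rw [List.Nodup, List.pairwise_map]
    exact i.strict.imp fun h => (Finset.card_lt_card h).ne
  rw [← List.length_map (as := i.chain) Finset.card, ← List.toFinset_card_of_nodup hnodup]
  refine (Finset.card_le_card (t := Finset.Icc 1 (i.chain.getLast i.chain_ne_nil).card) ?_).trans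
    (by simp)
  intro k hk
  simp only [List.mem_toFinset, List.mem_map] at hk
  obtain ⟨S, hS, rfl⟩ := hk
  exact Finset.mem_Icc.mpr ⟨(i.nonempty S hS).card_pos, Finset.card_le_card (i.subset_getLast hS)⟩

lemma dim_le (i : Idx n) (τ : SignType) : i.dim τ ≤ n + 1 := by
  have h1 := i.length_chain_le
  have h2 : Disjoint i.J (i.chain.getLast i.chain_ne_nil) :=
    Finset.disjoint_union_left.mpr ⟨i.Jle_disjoint, i.Jge_disjoint⟩
  have h3 := Finset.card_union_of_disjoint h2 ▸
    Finset.card_le_univ (i.J ∪ i.chain.getLast i.chain_ne_nil)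
  have h4 : absSign τ ≤ 1 := by cases τ <;> simp [absSign]
  have h5 : i.prec.delta ≤ 1 := by cases i.prec <;> simp [Prec.delta]
  have h6 := List.length_pos_iff.mpr i.chain_ne_nil
  rw [Fintype.card_fin] at h3
  rw [dim, dimFst, dimSnd]
  omega

/-- The index of a cell of top dimension. -/
def top (n : ℕ) : Idx n where
  chain := [{0}]
  chain_ne_nil := by simp
  nonempty := by simp
  strict := by simp
  Jle := ∅
  Jge := Finset.univ.erase 0
  Jle_disjoint := by simp
  Jge_disjoint := by simp
  J_disjoint := by simp
  prec := .le

lemma dim_top : (top n).dim 1 = n + 1 := by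
  have h : absSign 1 = 1 := by simp [absSign]
  simp [dim, dimFst, dimSnd, top, J, Prec.delta, h]

lemma nonempty_top : ((top n).cellSet 1).Nonempty := by
  rw [cellSet_nonempty_iff, length_signSupport]
  simp [top, Prec.delta]

/-- A parametrization of a nonempty cell by a closed ball. -/
lemma exists_ballMap (i : Idx n) (τ : SignType) (h : (i.cellSet τ).Nonempty) {d : ℕ}
    (hd : i.dim τ = d) : ∃ F : (Fin d → ℝ) → Fin (n + 1) → ℂ,
      ContinuousOn F (closedBall 0 1) ∧ InjOn F (closedBall 0 1) ∧
      F '' closedBall 0 1 = i.cellSet τ ∧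
      ∀ x ∈ closedBall (0 : Fin d → ℝ) 1, ∃ s, F x = i.param τ (i.dimFst τ) i.dimSnd s ∧
        (x ∈ ball (0 : Fin d → ℝ) 1 ↔ (∀ a, 0 < s.1 a) ∧ ∀ b, 0 < s.2 b) := by
  classical
  obtain ⟨e, he⟩ := exists_homeomorph_closedBall (p := i.dimFst τ) (q := i.dimSnd) (d := d) hd
  let F : (Fin d → ℝ) → Fin (n + 1) → ℂ := fun x =>
    if hx : x ∈ closedBall (0 : Fin d → ℝ) 1 then
      i.param τ (i.dimFst τ) i.dimSnd (e.symm ⟨x, hx⟩) else 0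
  have hF : ∀ x (hx : x ∈ closedBall (0 : Fin d → ℝ) 1),
      F x = i.param τ (i.dimFst τ) i.dimSnd (e.symm ⟨x, hx⟩) := fun x hx => dif_pos hx
  refine ⟨F, ?_, ?_, ?_, ?_⟩
  · rw [continuousOn_iff_continuous_domRestrict]
    convert! (i.param τ (i.dimFst τ) i.dimSnd).continuous.comp e.symm.continuous using 1
    funext x
    exact hF x.1 x.2
  · intro x hx y hy hxy
    rw [hF x hx, hF y hy] at hxy
    exact congrArg Subtype.val (e.symm.injective (param_injective h hxy))
  · ext z
    constructor
    · rintro ⟨x, hx, rfl⟩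
      rw [hF x hx]
      exact param_mem h _
    · intro hz
      obtain ⟨s, rfl⟩ := exists_param_eq h hz
      exact ⟨e s, (e s).2, by rw [hF _ (e s).2, Subtype.coe_eta, e.symm_apply_apply]⟩
  · intro x hx
    refine ⟨e.symm ⟨x, hx⟩, hF x hx, ?_⟩
    rw [← he, e.apply_symm_apply]

end Idx

/-- The indices of the `d`-dimensional cells of `Y`. -/
abbrev CellIdx (n d : ℕ) : Type :=
  {c : Idx n × SignType // (c.1.cellSet c.2).Nonempty ∧ c.1.dim c.2 = d}

/-- The parametrization of a cell by a closed ball. -/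
def ballMap {d : ℕ} (c : CellIdx n d) : (Fin d → ℝ) → Fin (n + 1) → ℂ :=
  (c.1.1.exists_ballMap c.1.2 c.2.1 c.2.2).choose

lemma continuousOn_ballMap {d : ℕ} (c : CellIdx n d) : ContinuousOn (ballMap c) (closedBall 0 1) :=
  (c.1.1.exists_ballMap c.1.2 c.2.1 c.2.2).choose_spec.1

lemma injOn_ballMap {d : ℕ} (c : CellIdx n d) : InjOn (ballMap c) (closedBall 0 1) :=
  (c.1.1.exists_ballMap c.1.2 c.2.1 c.2.2).choose_spec.2.1

lemma image_ballMap {d : ℕ} (c : CellIdx n d) :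
    ballMap c '' closedBall 0 1 = c.1.1.cellSet c.1.2 :=
  (c.1.1.exists_ballMap c.1.2 c.2.1 c.2.2).choose_spec.2.2.1

lemma exists_ballMap_eq {d : ℕ} (c : CellIdx n d) {x : Fin d → ℝ}
    (hx : x ∈ closedBall (0 : Fin d → ℝ) 1) :
    ∃ s, ballMap c x = c.1.1.param c.1.2 (c.1.1.dimFst c.1.2) c.1.1.dimSnd s ∧
      (x ∈ ball (0 : Fin d → ℝ) 1 ↔ (∀ a, 0 < s.1 a) ∧ ∀ b, 0 < s.2 b) :=
  (c.1.1.exists_ballMap c.1.2 c.2.1 c.2.2).choose_spec.2.2.2 x hx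

/-- The characteristic map of a cell, as a partial equivalence with source the open ball. -/
def charMap {d : ℕ} (c : CellIdx n d) : PartialEquiv (Fin d → ℝ) (Fin (n + 1) → ℂ) :=
  ((injOn_ballMap c).mono ball_subset_closedBall).toPartialEquiv (ballMap c) (ball 0 1)

/-- The CW structure on `Y` whose closed cells are the nonempty sets `e_i^τ`. -/
abbrev cwStructure (n : ℕ) : Topology.CWComplex (unionY n) :=
  Topology.CWComplex.mkFinite (unionY n)
    (cell := fun d => CellIdx n d)
    (map := fun d c => charMap c)
    (eventually_isEmpty_cell := by
      filter_upwards [Filter.eventually_gt_atTop (n + 1)] with d hd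
      refine ⟨fun c => ?_⟩
      have := c.1.1.dim_le c.1.2
      have := c.2.2
      omega)
    (finite_cell := fun d => inferInstance)
    (source_eq := fun d c => rfl)
    (continuousOn := fun d c => continuousOn_ballMap c)
    (continuousOn_symm := fun d c => continuousOn_invFunOn (isCompact_closedBall 0 1)
      ball_subset_closedBall (continuousOn_ballMap c) (injOn_ballMap c))
    (pairwiseDisjoint' := by
      rintro ⟨d, c⟩ - ⟨d', c'⟩ - hne
      refine Set.disjoint_left.mpr ?_
      rintro z ⟨x, hx, rfl⟩ ⟨x', hx', hxx⟩
      obtain ⟨s, hs, hs'⟩ := exists_ballMap_eq c (ball_subset_closedBall hx)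
      obtain ⟨t, ht, ht'⟩ := exists_ballMap_eq c' (ball_subset_closedBall hx')
      have hst : ballMap c' x' = ballMap c x := hxx
      rw [hs, ht] at hst
      obtain ⟨h1, h2⟩ := Idx.eq_of_param_eq c'.2.1 c.2.1 (ht'.mp hx') (hs'.mp hx) hst
      refine hne ?_
      obtain ⟨⟨i, τ⟩, hc, rfl⟩ := c
      obtain ⟨⟨i', τ'⟩, hc', rfl⟩ := c'
      dsimp only at h1 h2
      subst h1 h2
      rfl)
    (mapsTo_iff_image_subset := by
      intro d c x hx
      obtain ⟨s, hs, hs'⟩ := exists_ballMap_eq c (sphere_subset_closedBall hx)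
      have hxb : x ∉ ball (0 : Fin d → ℝ) 1 := fun hxb =>
        (mem_ball.mp hxb).ne (mem_sphere.mp hx)
      obtain ⟨i', τ', hmem, hdim⟩ := Idx.exists_face_of_not_pos c.2.1 (fun h => hxb (hs'.mpr h))
      rw [c.2.2] at hdim
      simp only [Set.mem_iUnion]
      refine ⟨i'.dim τ', hdim, ⟨(i', τ'), ⟨_, hmem⟩, rfl⟩, ?_⟩
      change ballMap c x ∈ ballMap _ '' closedBall 0 1
      rw [image_ballMap, hs]
      exact hmem)
    (union' := by
      ext z
      simp only [Set.mem_iUnion, unionY]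
      constructor
      · rintro ⟨d, c, hz⟩
        change z ∈ ballMap c '' closedBall 0 1 at hz
        rw [image_ballMap] at hz
        exact ⟨c.1.2, c.1.1, hz⟩
      · rintro ⟨τ, i, hz⟩
        refine ⟨i.dim τ, ⟨(i, τ), ⟨z, hz⟩, rfl⟩, ?_⟩
        change z ∈ ballMap _ '' closedBall 0 1
        rw [image_ballMap]
        exact hz)

lemma closedCell_cwStructure (d : ℕ) (c : CellIdx n d) :
    @Topology.RelCWComplex.closedCell _ _ (unionY n) ∅
      (@Topology.CWComplex.instRelCWComplex _ _ (unionY n) (cwStructure n)) d c =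
      c.1.1.cellSet c.1.2 :=
  image_ballMap c

end CW

/-! ### The boundary formula -/

section Boundary

variable {n : ℕ}

/-- An alternating sum over the positions in the list of the labels of nonzero sign, as a sum over
all labels. -/
lemma sum_signSupport {M : Type} [AddCommGroup M] (σ : Fin (n + 3) → SignType)
    (F : Fin (n + 3) → M) :
    ∑ a ∈ Finset.range (signSupport σ).length, (-1 : ℤ) ^ a • F (listLabel (signSupport σ) a) =
      ∑ x, if σ x ≠ 0 then
        (-1 : ℤ) ^ (Finset.univ.filter fun y => σ y ≠ 0 ∧ y < x).card • F x else 0 := by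
  classical
  rw [← Finset.sum_filter]
  have hinj := listLabel_injective (nodup_signSupport σ) rfl
  have hmono : ∀ a b, a < b → b < (signSupport σ).length →
      listLabel (signSupport σ) a < listLabel (signSupport σ) b := by
    intro a b hab hb
    rw [listLabel, listLabel, List.getD_eq_getElem _ _ (hab.trans hb), List.getD_eq_getElem _ _ hb]
    exact List.pairwise_iff_getElem.mp (Finset.sortedLT_sort _).pairwise _ _ (hab.trans hb) hb hab
  refine Finset.sum_bij (fun a _ => listLabel (signSupport σ) a) ?_ ?_ ?_ ?_
  · intro a ha
    exact Finset.mem_filter.mpr ⟨Finset.mem_univ _,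
      mem_signSupport.mp (listLabel_mem (Finset.mem_range.mp ha))⟩
  · intro a ha b hb hab
    exact congrArg Fin.val (@hinj ⟨a, Finset.mem_range.mp ha⟩ ⟨b, Finset.mem_range.mp hb⟩ hab)
  · intro x hx
    obtain ⟨a, ha⟩ := exists_listLabel_eq rfl (mem_signSupport.mpr (Finset.mem_filter.mp hx).2)
    exact ⟨a, Finset.mem_range.mpr a.2, ha⟩
  · intro a ha
    rw [Finset.mem_range] at ha
    have hset : (Finset.univ.filter fun y => σ y ≠ 0 ∧ y < listLabel (signSupport σ) a) =
        (Finset.range a).image (listLabel (signSupport σ)) := by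
      ext y
      simp only [Finset.mem_filter, Finset.mem_univ, true_and, Finset.mem_image, Finset.mem_range]
      constructor
      · rintro ⟨hy, hlt⟩
        obtain ⟨b, rfl⟩ := exists_listLabel_eq rfl (mem_signSupport.mpr hy)
        refine ⟨b, ?_, rfl⟩
        rcases lt_trichotomy (b : ℕ) a with h | h | h
        · exact h
        · rw [h] at hlt
          exact absurd hlt (lt_irrefl _)
        · exact absurd hlt (hmono _ _ h b.2).asymm
      · rintro ⟨b, hb, rfl⟩
        exact ⟨mem_signSupport.mp (listLabel_mem (hb.trans ha)), hmono _ _ hb ha⟩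
    rw [hset, Finset.card_image_of_injOn, Finset.card_range]
    intro b hb c hc hbc
    rw [Finset.coe_range, Set.mem_Iio] at hb hc
    exact congrArg Fin.val (@hinj ⟨b, hb.trans ha⟩ ⟨c, hc.trans ha⟩ hbc)

/-- Changing the signs at labels that do not occur does not change the image of a chain. -/
lemma pushChain_cellMap_congr {σ σ' : Fin (n + 3) → SignType} (hσ : ∃ l, σ (labelJ l) = 0)
    (hσ' : ∃ l, σ' (labelJ l) = 0) {h₁ : ℕ → Fin (n + 3)} (h₂ : ℕ → Finset (Fin (n + 1)))
    (p q d : ℕ) (hh : ∀ a < p + 1, σ' (h₁ a) ≠ 0) (h : ∀ x, σ' x ≠ 0 → σ x = σ' x) :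
    pushChain (cellMap σ hσ) d (gridChain h₁ h₂ d (shuffle (p + 1) (q + 1) d)) =
      pushChain (cellMap σ' hσ') d (gridChain h₁ h₂ d (shuffle (p + 1) (q + 1) d)) := by
  rw [← pushChain_productChain, pushChain_pushChain, pushChain_pushChain]
  congr 2
  ext1 s
  exact cellMap_congr hσ hσ' (isListWeight_labelMap (h := fun a : Fin (p + 1) => h₁ a)
    (fun a => mem_signSupport.mpr (hh a a.2)) s.1) h

namespace Idx

open scoped Classical in
/-- The singular chain representing the cell `e_i^τ` in degree `d`: it is `0` unless `d` is the
dimension of the cell. -/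
def cellChain (i : Idx n) (τ : SignType) (d : ℕ) : SingularChain (Fin (n + 1) → ℂ) d :=
  if (i.cellSet τ).Nonempty ∧ i.dim τ = d then
    pushChain (i.param τ (i.dimFst τ) i.dimSnd) d (productChain (i.dimFst τ) i.dimSnd d)
  else 0

variable {i : Idx n} {τ : SignType} {d : ℕ}

lemma cellChain_of_not (h : ¬ ((i.cellSet τ).Nonempty ∧ i.dim τ = d)) :
    i.cellChain τ d = 0 := if_neg h

lemma cellChain_eq (h : (i.cellSet τ).Nonempty) (hd : i.dim τ = d) :
    i.cellChain τ d = pushChain (i.param τ (i.dimFst τ) i.dimSnd) d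
      (productChain (i.dimFst τ) i.dimSnd d) := if_pos ⟨h, hd⟩

lemma cellChain_eq_gridChain {p q : ℕ} (h : (i.cellSet τ).Nonempty) (hp : i.dimFst τ = p)
    (hq : i.dimSnd = q) (hd : p + q = d) :
    i.cellChain τ d = pushChain (cellMap (i.signs τ) (i.exists_signs_eq_zero τ)) d
      (gridChain (listLabel (signSupport (i.signs τ))) (listLabel i.chain) d
        (shuffle (p + 1) (q + 1) d)) := by
  subst hp hq
  rw [cellChain_eq h hd, param, ← pushChain_pushChain, pushChain_productChain]

/-- The face of the chain of a cell opposite to a vertex of the first factor is the chain of the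
corresponding face of the cell. -/
lemma cellChain_faceFst (h : (i.cellSet τ).Nonempty) (hd : i.dim τ = d + 1) {a : ℕ}
    (ha : a < i.dimFst τ + 1) {i' : Idx n} {τ' : SignType}
    (hf : IsFaceFst i' τ' i τ (listLabel (signSupport (i.signs τ)) a)) :
    pushChain (cellMap (i.signs τ) (i.exists_signs_eq_zero τ)) d
      (gridChain (listLabel (signSupport (i.signs τ)) ∘ skip a) (listLabel i.chain) d
        (shuffle (i.dimFst τ) (i.dimSnd + 1) d)) = i'.cellChain τ' d := by
  rw [← length_signSupport_eq h] at ha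
  have hx := mem_signSupport.mp (listLabel_mem ha)
  by_cases h' : (i'.cellSet τ').Nonempty
  · obtain ⟨-, hp, hq⟩ := hf.dim_eq hx h'
    have hlab : listLabel (signSupport (i.signs τ)) ∘ skip a =
        listLabel (signSupport (i'.signs τ')) := by
      funext k
      rw [hf.signSupport_eq ha, listLabel_eraseIdx]
      rfl
    rw [cellChain_eq_gridChain h' rfl hq (by rw [dim] at hd; omega), hp, hlab, hf.chain_eq]
    refine pushChain_cellMap_congr _ _ _ _ _ _ (fun b hb => ?_) fun x hx' => ?_
    · exact mem_signSupport.mp (listLabel_mem (by rwa [length_signSupport_eq h']))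
    · rw [hf.signs_eq] at hx' ⊢
      rw [Function.update_of_ne]
      rintro rfl
      exact hx' (Function.update_self ..)
  · have hp : i.dimFst τ = 0 := by
      have h1 := hf.length_eq hx
      rw [cellSet_nonempty_iff] at h'
      rw [length_signSupport_eq h] at h1
      omega
    rw [cellChain_of_not fun h1 => h' h1.1, hp, shuffle_zero_left, map_zero, map_zero]

/-- The face of the chain of a cell opposite to a vertex of the second factor is the chain of the
corresponding face of the cell. -/
lemma cellChain_eraseI (h : (i.cellSet τ).Nonempty) (hd : i.dim τ = d + 1)
    (b : Fin i.chain.length) :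
    pushChain (cellMap (i.signs τ) (i.exists_signs_eq_zero τ)) d
      (gridChain (listLabel (signSupport (i.signs τ))) (listLabel i.chain ∘ skip b) d
        (shuffle (i.dimFst τ + 1) i.dimSnd d)) =
      if hlen : 1 < i.chain.length then (i.eraseI b hlen).cellChain τ d else 0 := by
  split_ifs with hlen
  · have hq := dimSnd_eraseI (i := i) b hlen
    have hlab : listLabel i.chain ∘ skip b = listLabel (i.eraseI b hlen).chain := by
      funext k
      rw [chain_eraseI, listLabel_eraseIdx]
      rfl
    rw [cellChain_eq_gridChain ((nonempty_eraseI_iff b hlen).mpr h) (dimFst_eraseI b hlen) rfl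
      (by rw [dim] at hd; omega), hlab, ← hq]
    rfl
  · have hq : i.dimSnd = 0 := by
      rw [dimSnd]
      omega
    rw [hq, shuffle_zero_right, map_zero, map_zero]

lemma boundaryFormula_eq_sum {M : Type} [AddCommGroup M] (e : Idx n → SignType → M) (i : Idx n)
    (τ : SignType) :
    boundaryFormula e i τ =
      (∑ a ∈ Finset.range (signSupport (i.signs τ)).length, (-1 : ℤ) ^ a •
        e (i.faceFst τ (listLabel (signSupport (i.signs τ)) a)).1
          (i.faceFst τ (listLabel (signSupport (i.signs τ)) a)).2) +
      (-1 : ℤ) ^ i.dimFst τ • ∑ j : Fin i.chain.length,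
        (-1 : ℤ) ^ (j : ℕ) • (if h : 1 < i.chain.length then e (i.eraseI j h) τ else 0) := by
  classical
  rw [sum_signSupport (i.signs τ) fun x => e (i.faceFst τ x).1 (i.faceFst τ x).2, sum_labels,
    boundaryFormula]
  congr 1
  simp only [faceFst_labelJ, faceFst_labelV, faceFst_labelO, i.signs_labelJ_ne_zero τ]
  have hJ : ∀ j, (Finset.univ.filter fun y => i.signs τ y ≠ 0 ∧ y < labelJ j).card =
      (i.J.filter (· < j)).card := by
    intro j
    rw [Finset.card_filter, sum_labels]
    simp only [i.signs_labelJ_ne_zero τ]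
    rw [if_neg (by simp [labelV, labelJ, Fin.lt_def]),
      if_neg (by simp [labelO, labelJ, Fin.lt_def]; omega), ← Finset.card_filter,
      add_zero, add_zero]
    congr 1
    ext k
    simp [labelJ]
  have hV : (Finset.univ.filter fun y => i.signs τ y ≠ 0 ∧ y < labelV n).card = i.J.card := by
    rw [Finset.card_filter, sum_labels]
    simp only [i.signs_labelJ_ne_zero τ]
    rw [if_neg (by simp), if_neg (by simp [labelO, labelV, Fin.lt_def]), ← Finset.card_filter,
      add_zero, add_zero]
    congr 1
    ext k
    simp only [labelJ, labelV, Fin.lt_def, Finset.mem_filter, Finset.mem_univ, true_and,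
      Fin.val_castSucc, Fin.val_last, and_iff_left k.2]
  have hO : (Finset.univ.filter fun y => i.signs τ y ≠ 0 ∧ y < labelO n).card =
      i.J.card + absSign τ := by
    rw [Finset.card_filter, sum_labels]
    simp only [i.signs_labelJ_ne_zero τ, i.signs_labelV]
    rw [if_neg (c := i.signs τ (labelO n) ≠ 0 ∧ _) (by simp), ← Finset.card_filter, add_zero]
    congr 1
    · congr 1
      ext k
      simp [labelJ, labelO, Fin.lt_def]
      omega
    · cases τ <;> simp [absSign, labelV, labelO, Fin.lt_def]
  simp only [hJ, hV, hO, i.signs_labelV, i.signs_labelO_ne_zero τ]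
  rw [← Finset.sum_filter, Finset.filter_mem_eq_inter, Finset.univ_inter]
  cases τ <;> cases i.prec <;> simp <;> abel

/-- The boundary formula holds for the singular chains representing the cells. -/
theorem singularBoundary_cellChain (i : Idx n) (τ : SignType) (d : ℕ) :
    singularBoundary d (i.cellChain τ (d + 1)) =
      boundaryFormula (fun i τ => i.cellChain τ d) i τ := by
  rw [boundaryFormula_eq_sum]
  by_cases h : (i.cellSet τ).Nonempty ∧ i.dim τ = d + 1
  · obtain ⟨h, hd⟩ := h
    have hd' : i.dimFst τ + i.dimSnd = d + 1 := hd
    rw [cellChain_eq_gridChain h rfl rfl hd', singularBoundary_pushChain,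
      singularBoundary_gridChain_shuffle hd', map_add, map_smul, map_sum, map_sum,
      length_signSupport_eq h]
    congr 1
    · refine Finset.sum_congr rfl fun a ha => ?_
      rw [map_smul, cellChain_faceFst h hd (Finset.mem_range.mp ha)
        (i.isFaceFst_faceFst τ _)]
    · rw [← i.length_chain, Finset.sum_range]
      refine congrArg _ (Finset.sum_congr rfl fun b _ => ?_)
      rw [map_smul, cellChain_eraseI h hd]
  · rw [cellChain_of_not h, map_zero]
    -- a face of dimension `d` belongs to a cell of dimension `d + 1`
    have h1 : ∀ a ∈ Finset.range (signSupport (i.signs τ)).length, (-1 : ℤ) ^ a •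
        (i.faceFst τ (listLabel (signSupport (i.signs τ)) a)).1.cellChain
          (i.faceFst τ (listLabel (signSupport (i.signs τ)) a)).2 d = 0 := by
      intro a ha
      rw [cellChain_of_not, smul_zero]
      rintro ⟨h', hd⟩
      obtain ⟨h2, h3, h4⟩ := (i.isFaceFst_faceFst τ _).dim_eq
        (mem_signSupport.mp (listLabel_mem (Finset.mem_range.mp ha))) h'
      rw [dim] at hd
      exact h ⟨h2, by rw [dim]; omega⟩
    have h2 : ∀ j : Fin i.chain.length,
        (if hlen : 1 < i.chain.length then (i.eraseI j hlen).cellChain τ d else 0) = 0 := by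
      intro j
      split_ifs with hlen
      · rw [cellChain_of_not]
        rintro ⟨h', hd⟩
        have h3 := dimSnd_eraseI (i := i) j hlen
        rw [dim, dimFst_eraseI] at hd
        exact h ⟨(nonempty_eraseI_iff j hlen).mp h', by rw [dim]; omega⟩
      · rfl
    rw [Finset.sum_eq_zero h1]
    simp only [h2, smul_zero, Finset.sum_const_zero, add_zero]

end Idx

lemma map_boundaryFormula {M N : Type} [AddCommGroup M] [AddCommGroup N] (f : M →ₗ[ℤ] N)
    (e : Idx n → SignType → M) (i : Idx n) (τ : SignType) :
    f (boundaryFormula e i τ) = boundaryFormula (fun i τ => f (e i τ)) i τ := by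
  rw [Idx.boundaryFormula_eq_sum, Idx.boundaryFormula_eq_sum, map_add, map_sum, map_smul, map_sum]
  simp only [map_smul, apply_dite f, map_zero]

lemma boundaryFormula_mem {M : Type} [AddCommGroup M] (S : Submodule ℤ M)
    {e : Idx n → SignType → M} (he : ∀ i τ, e i τ ∈ S) (i : Idx n) (τ : SignType) :
    boundaryFormula e i τ ∈ S := by
  have := map_boundaryFormula S.subtype (fun i τ => ⟨e i τ, he i τ⟩) i τ
  exact this ▸ Subtype.property _

lemma pushChain_mem_chainsIn {X Y : Type} [TopologicalSpace X] [TopologicalSpace Y] {A : Set Y}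
    {g : C(X, Y)} (hg : ∀ x, g x ∈ A) (d : ℕ) (c : SingularChain X d) :
    pushChain g d c ∈ chainsIn A d := by
  induction c using Finsupp.induction_linear with
  | zero => rw [map_zero]; exact Submodule.zero_mem _
  | add f g hf hg => rw [map_add]; exact Submodule.add_mem _ hf hg
  | single σ k =>
    rw [pushChain_single]
    refine Finsupp.single_mem_supported ℤ _ ?_
    rintro _ ⟨x, rfl⟩
    exact hg _

/-- The skeleton contains the cells of smaller dimension. -/
lemma cellSet_subset_skel {i : Idx n} {τ : SignType} (h : (i.cellSet τ).Nonempty) {d : ℕ}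
    (hd : i.dim τ = d) :
    i.cellSet τ ⊆ @skel _ _ _ (unionY n) (cwStructure n) (d + 1) := by
  let := cwStructure n
  refine (closedCell_cwStructure d ⟨(i, τ), h, hd⟩).ge.trans ?_
  exact Topology.RelCWComplex.closedCell_subset_skeletonLT (C := unionY n) d _

lemma cellChain_mem_chainsIn (i : Idx n) (τ : SignType) (d : ℕ) :
    i.cellChain τ d ∈ chainsIn (@skel _ _ _ (unionY n) (cwStructure n) (d + 1)) d := by
  by_cases h : (i.cellSet τ).Nonempty ∧ i.dim τ = d
  · rw [Idx.cellChain_eq h.1 h.2]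
    exact pushChain_mem_chainsIn (fun s => cellSet_subset_skel h.1 h.2 (Idx.param_mem h.1 s)) d _
  · rw [Idx.cellChain_of_not h]
    exact Submodule.zero_mem _

lemma cellChain_mem_relCycles (i : Idx n) (τ : SignType) (d : ℕ) :
    i.cellChain τ d ∈ relCycles (@skel _ _ _ (unionY n) (cwStructure n) (d + 1))
      (@skel _ _ _ (unionY n) (cwStructure n) d) d := by
  cases d with
  | zero => exact cellChain_mem_chainsIn i τ 0
  | succ d =>
    refine ⟨cellChain_mem_chainsIn i τ (d + 1), ?_⟩
    rw [SetLike.mem_coe, Submodule.mem_comap, Idx.singularBoundary_cellChain]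
    exact boundaryFormula_mem _ (fun i τ => cellChain_mem_chainsIn i τ d) i τ

/-- The class of the cell `e_i^τ` in the cellular chain group of degree `d`. -/
def cellClass (d : ℕ) (i : Idx n) (τ : SignType) :
    @CellularChain _ _ _ (unionY n) (cwStructure n) d :=
  @cellularClass _ _ _ (unionY n) (cwStructure n) d (i.cellChain τ d)
    (cellChain_mem_relCycles i τ d)

theorem cellularBoundary_cellClass (d : ℕ) (i : Idx n) (τ : SignType) :
    @cellularBoundary _ _ _ (unionY n) (cwStructure n) d (cellClass (d + 1) i τ) =
      boundaryFormula (cellClass d) i τ := by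
  let := cwStructure n
  let z : Idx n → SignType → relCycles (skel (unionY n) (d + 1)) (skel (unionY n) d) d :=
    fun i τ => ⟨i.cellChain τ d, cellChain_mem_relCycles i τ d⟩
  have hz : cycleBoundary _ _ _ d ⟨i.cellChain τ (d + 1), cellChain_mem_relCycles i τ (d + 1)⟩ =
      boundaryFormula z i τ := by
    refine Subtype.ext ?_
    refine (Idx.singularBoundary_cellChain i τ d).trans ?_
    exact (map_boundaryFormula (Submodule.subtype _) z i τ).symm
  change Submodule.Quotient.mk (cycleBoundary _ _ _ d _) = _
  rw [hz]
  exact map_boundaryFormula (Submodule.mkQ _) z i τ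

lemma Idx.cellSet_eq_empty_iff (i : Idx n) (τ : SignType) :
    i.cellSet τ = ∅ ↔ i.prec = Prec.eq ∧ i.J = ∅ ∧ τ = 0 := by
  rw [← Set.not_nonempty_iff_eq_empty, i.cellSet_nonempty_iff, i.length_signSupport,
    ← Finset.card_eq_zero]
  cases τ <;> cases i.prec <;> simp [absSign, Prec.delta]

end Boundary

end SphereComplex

end

theorem mainTheorem7 (n : ℕ) :
    -- a set `e_i^τ` is empty exactly if `≺` is `=`, `J_i = ∅` and `τ = 0`
    (∀ (i : SphereComplex.Idx n) (τ : SignType),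
      i.cellSet τ = ∅ ↔ i.prec = SphereComplex.Prec.eq ∧ i.J = ∅ ∧ τ = 0) ∧
    ∃ _cw : Topology.CWComplex (SphereComplex.unionY n),
      -- the cells are exactly the nonempty `e_i^τ`
      (∃ idx : ∀ d : ℕ, Topology.CWComplex.cell (SphereComplex.unionY n) d ≃
          {c : SphereComplex.Idx n × SignType //
            (c.1.cellSet c.2).Nonempty ∧ c.1.dim c.2 = d},
        ∀ (d : ℕ) (x : Topology.CWComplex.cell (SphereComplex.unionY n) d),
          Topology.CWComplex.closedCell (C := SphereComplex.unionY n) d x = (idx d x).1.1.cellSet (idx d x).1.2) ∧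
      -- the complex is regular
      (∀ (d : ℕ) (x : Topology.CWComplex.cell (SphereComplex.unionY n) d),
        Set.InjOn (Topology.CWComplex.map (C := SphereComplex.unionY n) d x) (Metric.closedBall 0 1)) ∧
      -- the complex has dimension `n + 1`
      Nonempty (Topology.CWComplex.cell (SphereComplex.unionY n) (n + 1)) ∧
      (∀ d : ℕ, n + 1 < d → IsEmpty (Topology.CWComplex.cell (SphereComplex.unionY n) d)) ∧
      -- each cell is homeomorphic to a product of two simplices
      ∃ φ : ∀ (i : SphereComplex.Idx n) (τ : SignType), (i.cellSet τ).Nonempty →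
          (stdSimplex ℝ (Fin (i.dimFst τ + 1)) × stdSimplex ℝ (Fin (i.dimSnd + 1)) ≃ₜ i.cellSet τ),
      -- the cellular chains `e_i^τ`, oriented by these homeomorphisms (in degree `dim e_i^τ`)
      ∃ e : ∀ d : ℕ, SphereComplex.Idx n → SignType →
          SphereComplex.CellularChain (SphereComplex.unionY n) d,
        (∀ (d : ℕ) (i : SphereComplex.Idx n) (τ : SignType) (h : (i.cellSet τ).Nonempty),
          i.dim τ = d →
          ∃ hc, e d i τ = SphereComplex.cellularClass (SphereComplex.unionY n)
            (SphereComplex.pushChain (⟨fun x => (φ i τ h x : Fin (n + 1) → ℂ), by fun_prop⟩ :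
                C(stdSimplex ℝ (Fin (i.dimFst τ + 1)) × stdSimplex ℝ (Fin (i.dimSnd + 1)),
                  Fin (n + 1) → ℂ)) d
              (SphereComplex.productChain (i.dimFst τ) i.dimSnd d)) hc) ∧
        (∀ (d : ℕ) (i : SphereComplex.Idx n) (τ : SignType),
          ¬((i.cellSet τ).Nonempty ∧ i.dim τ = d) → e d i τ = 0) ∧
        -- the boundary formula
        ∀ (d : ℕ) (i : SphereComplex.Idx n) (τ : SignType),
          SphereComplex.cellularBoundary (SphereComplex.unionY n) d (e (d + 1) i τ) =
            SphereComplex.boundaryFormula (e d) i τ := by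
  refine ⟨fun i τ => i.cellSet_eq_empty_iff τ, SphereComplex.cwStructure n,
    ⟨fun d => Equiv.refl _, fun d c => SphereComplex.closedCell_cwStructure d c⟩,
    fun d c => SphereComplex.injOn_ballMap c,
    ⟨⟨(SphereComplex.Idx.top n, 1), SphereComplex.Idx.nonempty_top,
      SphereComplex.Idx.dim_top⟩⟩,
    fun d hd => ⟨fun c => ?_⟩, SphereComplex.Idx.paramHomeo, SphereComplex.cellClass,
    fun d i τ h hd => ?_, fun d i τ h => ?_, SphereComplex.cellularBoundary_cellClass⟩
  · have h1 := c.1.1.dim_le c.1.2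
    have h2 := c.2.2
    omega
  · have heq := SphereComplex.Idx.cellChain_eq h hd
    exact ⟨heq ▸ SphereComplex.cellChain_mem_relCycles i τ d, by
      rw [SphereComplex.cellClass]
      congr 1⟩
  · have h0 := SphereComplex.Idx.cellChain_of_not h
    refine (Submodule.Quotient.mk_eq_zero _).mpr (Submodule.mem_sup_right ?_)
    change i.cellChain τ d ∈ _
    rw [h0]
    exact Submodule.zero_mem _
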